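/- Variables $x_1,x_2,\dots$ are indexed by the positive integers, and all polynomials lie in $\mathbb{Q}[x_i\mid i\ge 1]$. For a prime $p$ and a positive integer $n$, let $\nu_p(n)$ be the $p$-adic valuation, $n_p=p^{\nu_p(n)}$ and $n_{p'}=n/n_p$; let $\phi$ be Euler's totient function. Empty products are $1$ and empty sums are $0$. **Cycle counters.** For a permutation $g$ of a finite set having $k_i$ cycles of length $i$ (fixed points are cycles of length $1$), let $\operatorname{CT}(g)=\prod_i x_i^{k_i}$. For a set $X$ of permutations of a finite set, let $\operatorname{CC}(X)=\sum_{g\in X}\operatorname{CT}(g)$. For a positive integer $m$ and an integer $a$ with $\gcd(a,m)=1$, let $\operatorname{Hol}_a(\mathbb{Z}/m\mathbb{Z})$ be the set of the permutations $x\mapsto ax+b$ of $\mathbb{Z}/m\mathbb{Z}$, $b\in\mathbb{Z}/m\mathbb{Z}$. **The product $\circledast$.** Set $x_i^e\circledast x_j^f=x_{\operatorname{lcm}(i,j)}^{ef\gcd(i,j)}$ and $\left(\prod_i x_i^{s_i}\right)\circledast\left(\prod_j x_j^{t_j}\right)=\prod_{i,j}\left(x_i^{s_i}\circledast x_j^{t_j}\right)$,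 and extend $\mathbb{Q}$-bilinearly to polynomials. This product is commutative and associative with neutral element $x_1$, so $\circledast$-products of families with all but finitely many members equal to $x_1$ are defined. **Order data.** Let $p$ be a prime, $k\ge 0$, and $a$ an integer with $\gcd(p^k,a)=1$. If $p>2$, let $\operatorname{o}_{p^k}(a)$ be the multiplicative order of $a$ modulo $p^k$. If $p=2$ and $k\le 1$, let $\operatorname{o}_{p^k}(a)=(0,1)$. If $p=2$ and $k\ge 2$, write $a=(-1)^{\epsilon}a'$ in $\mathbb{Z}/2^k\mathbb{Z}$ with $\epsilon\in\{0,1\}$ and $a'$ a power of $5$ (such $\epsilon,a'$ are unique), and let $\operatorname{o}_{2^k}(a)=(\epsilon,\operatorname{ord}(a'))$, where $\operatorname{ord}(a')$ is the multiplicative order of $a'$ modulo $2^k$. Let $\Omega(p^k)=\{\operatorname{o}_{p^k}(a)\mid a\in\mathbb{Z},\ \gcd(p^k,a)=1\}$. For a positive integer $m$ and $\gcd(a,m)=1$, let $\vec{\operatorname{o}}_m(a)=(\operatorname{o}_{p^{\nu_p(m)}}(a))_p$, indexed by all primes $p$. **The polynomials $\Gamma_{p^k}(o)$**, for $o\in\Omega(p^k)$: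 * If $p>2$ and $o\nmid\phi(p^k)_p$: $$\Gamma_{p^k}(o)=p^k\,x_1\,x_{o_{p'}}^{(p^{k-\nu_p(o)}-1)/o_{p'}}\prod_{u=1}^{\nu_p(o)}x_{p^uo_{p'}}^{p^{k-1-\nu_p(o)}(p-1)/o_{p'}}.$$ * If $p>2$ and $o\mid\phi(p^k)_p$: $$\Gamma_{p^k}(o)=o\,x_1^{p^k/o}\prod_{u=1}^{\nu_p(o)}x_{p^u}^{\frac{p^{k-1}}{o}(p-1)}+\sum_{v=0}^{k-\nu_p(o)-1}\phi(p^{k-v})\,x_{p^{k-v}}^{p^v}.$$ * $\Gamma_{2^0}((0,1))=x_1$, $\ \Gamma_{2^1}((0,1))=x_1^2+x_2$, $\ \Gamma_4((0,1))=x_1^4+x_2^2+2x_4$, $\ \Gamma_4((1,1))=2x_1^2x_2+2x_2^2$. * If $p=2$, $k\ge 3$ and $o=(\epsilon,o')$, put $\nu=k-2-\nu_2(o')$ and $\nu'=\min(k-3,\nu)$. Then $$\Gamma_{2^k}((1,o'))=2^{k-1}x_{2^{k-1-\nu}}^{2^{1+\nu}}+2^{k-1}x_1^2x_2^{2^{2+\nu'}-1}\prod_{u=2}^{k-2-\nu'}x_{2^u}^{2^{1+\nu'}},$$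 $$\Gamma_{2^k}((0,o'))=2^{k-2-\nu}x_1^{2^{2+\nu}}\prod_{u=1}^{k-2-\nu}x_{2^u}^{2^{1+\nu}}+\sum_{v=0}^{1+\nu}\phi(2^{k-v})\,x_{2^{k-v}}^{2^v}.$$ **Proposition.** 1. Let $p$ be a prime, $k\ge 0$ and $o\in\Omega(p^k)$. For every integer $a$ with $\gcd(p^k,a)=1$ and $\operatorname{o}_{p^k}(a)=o$, $$\operatorname{CC}(\operatorname{Hol}_a(\mathbb{Z}/p^k\mathbb{Z}))=\Gamma_{p^k}(o).$$ 2. Let $m$ be a positive integer and $\vec{\operatorname{o}}=(o_p)_p\in\prod_p\Omega(p^{\nu_p(m)})$. For every integer $a$ with $\gcd(m,a)=1$ and $\vec{\operatorname{o}}_m(a)=\vec{\operatorname{o}}$, all but finitely many of the polynomials $\Gamma_{p^{\nu_p(m)}}(o_p)$ are equal to $x_1$, and $$\operatorname{CC}(\operatorname{Hol}_a(\mathbb{Z}/m\mathbb{Z}))=\circledast_{p}\ \Gamma_{p^{\nu_p(m)}}(o_p),$$ the product being taken over all primes $p$. 3. In particular, for a positive integer $m$ and integers $a,\tilde a$ coprime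 to $m$ with $\vec{\operatorname{o}}_m(a)=\vec{\operatorname{o}}_m(\tilde a)$, one has $\operatorname{CC}(\operatorname{Hol}_a(\mathbb{Z}/m\mathbb{Z}))=\operatorname{CC}(\operatorname{Hol}_{\tilde a}(\mathbb{Z}/m\mathbb{Z}))$. -/

import Mathlib

open MvPolynomial

/-- The variable `x_n` of the polynomial ring `ℚ[x_i ∣ i ∈ ℕ⁺]`, for a positive integer `n`. -/
noncomputable def cycVar (n : ℕ) : MvPolynomial ℕ+ ℚ := X n.toPNat'

section CycleCounter

open Classical in
/-- The cycle type `CT(g) = x_1^{k_1} x_2^{k_2} ⋯` of a permutation `g` of a finite set, where `k_i`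
is the number of cycles of length `i` of `g`. The multiset `g.partition.parts` lists the lengths
of all cycles of `g`, including the cycles of length one (fixed points). -/
noncomputable def cycleTypeMonomial {Ω : Type*} [Fintype Ω] (g : Equiv.Perm Ω) :
    MvPolynomial ℕ+ ℚ :=
  (g.partition.parts.map cycVar).prod

open Classical in
/-- The cycle counter `CC(X) = ∑_{g ∈ X} CT(g)` of a set `X` of permutations of a finite set. -/
noncomputable def cycleCounter {Ω : Type*} [Fintype Ω] (S : Set (Equiv.Perm Ω)) :
    MvPolynomial ℕ+ ℚ :=
  ∑ g : Equiv.Perm Ω with g ∈ S, cycleTypeMonomial g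

/-- The set `Hol_a(ℤ/mℤ)` of all affine permutations of `ℤ/mℤ` of the form `x ↦ a x + b` with
`b ∈ ℤ/mℤ`. -/
def holA (m : ℕ) (a : ℤ) : Set (Equiv.Perm (ZMod m)) :=
  {f | ∃ b : ZMod m, ∀ x : ZMod m, f x = (a : ZMod m) * x + b}

end CycleCounter

section StarProduct

variable {R : Type*} [CommSemiring R]

/-- The `⊛`-product of the monomials `∏ x_i ^ s_i` and `∏ x_j ^ t_j`, namely
`∏_{i,j} (x_i ^ s_i ⊛ x_j ^ t_j)` with `x_i ^ e ⊛ x_j ^ f = x_{lcm(i,j)} ^ (e f gcd(i,j))`. -/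
noncomputable def starMonomial (K : Type*) [CommSemiring K] (s t : ℕ+ →₀ ℕ) : MvPolynomial ℕ+ K :=
  ∏ i ∈ s.support, ∏ j ∈ t.support, X (PNat.lcm i j) ^ (s i * t j * (PNat.gcd i j : ℕ))

/-- The `⊛`-product of two polynomials, the bilinear extension of the product on monomials. -/
noncomputable def starProduct (f g : MvPolynomial ℕ+ R) : MvPolynomial ℕ+ R :=
  ∑ s ∈ f.support, ∑ t ∈ g.support, C (f.coeff s * g.coeff t) * starMonomial R s t

/-- The exponent vector of a `⊛`-product of monomials. -/
noncomputable def starExp (s t : ℕ+ →₀ ℕ) : ℕ+ →₀ ℕ :=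
  s.sum fun i e => t.sum fun j f => Finsupp.single (PNat.lcm i j) (e * f * (PNat.gcd i j : ℕ))

theorem starMonomial_eq (s t : ℕ+ →₀ ℕ) : starMonomial R s t = monomial (starExp s t) 1 := by
  unfold starMonomial starExp
  simp only [Finsupp.sum, X_pow_eq_monomial, monomial_sum_one]

theorem starExp_add_left (s s' t : ℕ+ →₀ ℕ) :
    starExp (s + s') t = starExp s t + starExp s' t := by
  unfold starExp
  rw [Finsupp.sum_add_index']
  · intro i; simp
  · intro i e e'
    simp only [Finsupp.sum, add_mul, Finsupp.single_add, Finset.sum_add_distrib]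

theorem starExp_comm (s t : ℕ+ →₀ ℕ) : starExp s t = starExp t s := by
  unfold starExp
  rw [Finsupp.sum_comm]
  refine Finsupp.sum_congr fun j _ => Finsupp.sum_congr fun i _ => ?_
  have h1 : PNat.lcm i j = PNat.lcm j i := PNat.eq (Nat.lcm_comm _ _)
  rw [h1, PNat.gcd_comm, mul_comm (s i)]

theorem starExp_add_right (s t t' : ℕ+ →₀ ℕ) :
    starExp s (t + t') = starExp s t + starExp s t' := by
  rw [starExp_comm, starExp_add_left, starExp_comm t, starExp_comm t']

theorem starExp_zero_left (t : ℕ+ →₀ ℕ) : starExp 0 t = 0 := by simp [starExp]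

theorem starExp_zero_right (t : ℕ+ →₀ ℕ) : starExp t 0 = 0 := by simp [starExp]

theorem starExp_single (i j : ℕ+) (e f : ℕ) :
    starExp (Finsupp.single i e) (Finsupp.single j f) =
      Finsupp.single (PNat.lcm i j) (e * f * (PNat.gcd i j : ℕ)) := by
  simp [starExp]

theorem starExp_one (t : ℕ+ →₀ ℕ) : starExp (Finsupp.single 1 1) t = t := by
  induction t using Finsupp.induction_linear with
  | zero => exact starExp_zero_right _
  | add f g hf hg => rw [starExp_add_right, hf, hg]
  | single j f =>
    have h1 : PNat.lcm 1 j = j := PNat.eq (Nat.lcm_one_left _)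
    have h2 : PNat.gcd 1 j = 1 := PNat.eq (Nat.gcd_one_left _)
    rw [starExp_single, h1, h2]; simp

theorem starExp_assoc (s t u : ℕ+ →₀ ℕ) :
    starExp (starExp s t) u = starExp s (starExp t u) := by
  induction s using Finsupp.induction_linear with
  | zero => simp only [starExp_zero_left]
  | add f g hf hg => simp only [starExp_add_left, hf, hg]
  | single i e =>
  induction t using Finsupp.induction_linear with
  | zero => simp only [starExp_zero_left, starExp_zero_right]
  | add f g hf hg => simp only [starExp_add_left, starExp_add_right, hf, hg]
  | single j f =>
  induction u using Finsupp.induction_linear with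
  | zero => simp only [starExp_zero_right]
  | add f g hf hg => simp only [starExp_add_right, hf, hg]
  | single k h =>
    simp only [starExp_single]
    have h1 : PNat.lcm (PNat.lcm i j) k = PNat.lcm i (PNat.lcm j k) :=
      PNat.eq (Nat.lcm_assoc _ _ _)
    have h2 : (PNat.gcd i j : ℕ) * PNat.gcd (PNat.lcm i j) k
        = PNat.gcd j k * PNat.gcd i (PNat.lcm j k) := by
      have h3 : PNat.gcd i j * PNat.gcd (PNat.lcm i j) k
          = PNat.gcd j k * PNat.gcd i (PNat.lcm j k) := by
        apply mul_right_cancel (b := PNat.lcm (PNat.lcm i j) k)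
        rw [mul_assoc, PNat.gcd_mul_lcm, ← mul_assoc, PNat.gcd_mul_lcm, h1, mul_assoc, mul_assoc,
          PNat.gcd_mul_lcm, mul_left_comm (PNat.gcd j k), PNat.gcd_mul_lcm]
      exact_mod_cast congrArg PNat.val h3
    rw [h1]
    congr 1
    calc e * f * (PNat.gcd i j : ℕ) * h * (PNat.gcd (PNat.lcm i j) k : ℕ)
        = e * f * h * ((PNat.gcd i j : ℕ) * PNat.gcd (PNat.lcm i j) k) := by ring
      _ = _ := by rw [h2]; ring

theorem starProduct_comm (f g : MvPolynomial ℕ+ R) : starProduct f g = starProduct g f := by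
  unfold starProduct
  rw [Finset.sum_comm]
  simp only [starMonomial_eq, mul_comm (coeff _ f), starExp_comm]

theorem starProduct_eq_of_subset (f g : MvPolynomial ℕ+ R) (A B : Finset (ℕ+ →₀ ℕ))
    (hA : f.support ⊆ A) (hB : g.support ⊆ B) :
    starProduct f g = ∑ s ∈ A, ∑ t ∈ B, C (f.coeff s * g.coeff t) * starMonomial R s t := by
  unfold starProduct
  rw [Finset.sum_subset hA]
  · refine Finset.sum_congr rfl fun s _ => Finset.sum_subset hB fun t _ ht => ?_
    rw [notMem_support_iff.mp ht]; simp
  · intro s _ hs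
    rw [notMem_support_iff.mp hs]; simp

theorem starProduct_add_left (f f' g : MvPolynomial ℕ+ R) :
    starProduct (f + f') g = starProduct f g + starProduct f' g := by
  classical
  rw [starProduct_eq_of_subset (f + f') g (f.support ∪ f'.support) g.support support_add subset_rfl,
    starProduct_eq_of_subset f g (f.support ∪ f'.support) g.support
      Finset.subset_union_left subset_rfl,
    starProduct_eq_of_subset f' g (f.support ∪ f'.support) g.support
      Finset.subset_union_right subset_rfl]
  simp only [coeff_add, add_mul, C_add, Finset.sum_add_distrib]

theorem starProduct_add_right (f g g' : MvPolynomial ℕ+ R) :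
    starProduct f (g + g') = starProduct f g + starProduct f g' := by
  rw [starProduct_comm, starProduct_add_left, starProduct_comm g, starProduct_comm g']

theorem starProduct_monomial (s t : ℕ+ →₀ ℕ) (a b : R) :
    starProduct (monomial s a) (monomial t b) = monomial (starExp s t) (a * b) := by
  rw [starProduct_eq_of_subset _ _ {s} {t} support_monomial_subset support_monomial_subset]
  simp [starMonomial_eq, C_mul_monomial]

theorem starProduct_assoc (f g h : MvPolynomial ℕ+ R) :
    starProduct (starProduct f g) h = starProduct f (starProduct g h) := by
  induction f using MvPolynomial.induction_on' with
  | add p q hp hq => simp only [starProduct_add_left, hp, hq]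
  | monomial s a =>
  induction g using MvPolynomial.induction_on' with
  | add p q hp hq => simp only [starProduct_add_left, starProduct_add_right, hp, hq]
  | monomial t b =>
  induction h using MvPolynomial.induction_on' with
  | add p q hp hq => simp only [starProduct_add_right, hp, hq]
  | monomial u c => simp only [starProduct_monomial, starExp_assoc, mul_assoc]

theorem X_one_starProduct (f : MvPolynomial ℕ+ R) : starProduct (X 1) f = f := by
  induction f using MvPolynomial.induction_on' with
  | add p q hp hq => rw [starProduct_add_right, hp, hq]
  | monomial s a => rw [X, starProduct_monomial, starExp_one, one_mul]

/-- Polynomials in the variables `x_1, x_2, …` form a commutative monoid under the `⊛`-product,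
with neutral element `x_1`. -/
noncomputable abbrev starCommMonoid (K : Type*) [CommSemiring K] :
    CommMonoid (MvPolynomial ℕ+ K) where
  mul := starProduct
  one := X 1
  mul_assoc := starProduct_assoc
  mul_comm := starProduct_comm
  one_mul := X_one_starProduct
  mul_one f := (starProduct_comm f (X 1)).trans (X_one_starProduct f)
  npow := @npowRec _ ⟨X 1⟩ ⟨starProduct⟩

/-- The `⊛`-product of a family of polynomials all but finitely many of which are equal to the
neutral element `x_1`. -/
noncomputable def starFinprod {ι : Type*} (f : ι → MvPolynomial ℕ+ R) : MvPolynomial ℕ+ R :=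
  @finprod (MvPolynomial ℕ+ R) ι (starCommMonoid R) f

end StarProduct

/-- The values of `o_{p^k}`: a positive integer (an order) for an odd prime `p`, and a pair
`(ε, o')` for `p = 2`. -/
inductive OrderDatum where
  | odd (o : ℕ) : OrderDatum
  | two (ε : Fin 2) (o' : ℕ) : OrderDatum

open Classical in
/-- The order datum `o_{p^k}(a)` of an integer `a` coprime to the prime power `p^k`. For `p > 2` it
is the multiplicative order of `a` modulo `p^k`. For `p = 2` and `k ≤ 1` it is `(0, 1)`. For `p = 2`
and `k > 1` it is `(ε, ord(a'))` where `a = (-1)^ε a'` in `ℤ/2^kℤ` with `a'` a power of `5`; here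
`ε = 0` precisely if `a` itself is a power of `5` in `ℤ/2^kℤ`, and otherwise `ε = 1`, `a' = -a`. -/
noncomputable def orderDatum (p k : ℕ) (a : ℤ) : OrderDatum :=
  if p = 2 then
    if k ≤ 1 then .two 0 1
    else if (a : ZMod (2 ^ k)) ∈ Submonoid.powers (5 : ZMod (2 ^ k)) then
      .two 0 (orderOf (a : ZMod (2 ^ k)))
    else .two 1 (orderOf (-(a : ZMod (2 ^ k))))
  else .odd (orderOf (a : ZMod (p ^ k)))

/-- `Ω(p^k) = {o_{p^k}(a) ∣ a ∈ ℤ, gcd(p^k, a) = 1}`. -/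
def orderData (p k : ℕ) : Set OrderDatum :=
  {o | ∃ a : ℤ, IsCoprime ((p ^ k : ℕ) : ℤ) a ∧ orderDatum p k a = o}

/-- The family `(o_{p^{ν_p(m)}}(a))_p`, indexed by all primes `p`. -/
noncomputable def orderVector (m : ℕ) (a : ℤ) : Nat.Primes → OrderDatum :=
  fun p => orderDatum p (padicValNat p m) a

/-- The `p`-part `n_p = p^{ν_p(n)}` of a positive integer `n`. -/
def primePart (p n : ℕ) : ℕ := p ^ padicValNat p n

/-- The `p'`-part `n_{p'} = n / n_p` of a positive integer `n`. -/
def coprimePart (p n : ℕ) : ℕ := n / primePart p n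

/-- `Γ_{p^k}(o)` for an odd prime `p`. -/
noncomputable def gammaOdd (p k o : ℕ) : MvPolynomial ℕ+ ℚ :=
  if o ∣ primePart p (Nat.totient (p ^ k)) then
    (o : MvPolynomial ℕ+ ℚ) * cycVar 1 ^ (p ^ k / o)
        * ∏ u ∈ Finset.Icc 1 (padicValNat p o), cycVar (p ^ u) ^ (p ^ (k - 1) / o * (p - 1))
      + ∑ v ∈ Finset.range (k - padicValNat p o),
          (Nat.totient (p ^ (k - v)) : MvPolynomial ℕ+ ℚ) * cycVar (p ^ (k - v)) ^ (p ^ v)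
  else
    ((p ^ k : ℕ) : MvPolynomial ℕ+ ℚ) * cycVar 1
      * cycVar (coprimePart p o) ^ ((p ^ (k - padicValNat p o) - 1) / coprimePart p o)
      * ∏ u ∈ Finset.Icc 1 (padicValNat p o), cycVar (p ^ u * coprimePart p o) ^
          (p ^ (k - 1 - padicValNat p o) * (p - 1) / coprimePart p o)

/-- `Γ_4((ε, 1))`. -/
noncomputable def gammaFour (ε : Fin 2) : MvPolynomial ℕ+ ℚ :=
  if ε = 0 then cycVar 1 ^ 4 + cycVar 2 ^ 2 + 2 * cycVar 4
  else 2 * cycVar 1 ^ 2 * cycVar 2 + 2 * cycVar 2 ^ 2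

/-- `Γ_{2^k}((ε, o'))` for `k ≥ 3`, in terms of `k`, `ε` and `ν = k - 2 - ν_2(o')`. -/
noncomputable def gammaTwoPow (k : ℕ) (ε : Fin 2) (ν : ℕ) : MvPolynomial ℕ+ ℚ :=
  if ε = 1 then
    2 ^ (k - 1) * cycVar (2 ^ (k - 1 - ν)) ^ (2 ^ (1 + ν))
      + 2 ^ (k - 1) * cycVar 1 ^ 2 * cycVar 2 ^ (2 ^ (2 + min (k - 3) ν) - 1)
        * ∏ u ∈ Finset.Icc 2 (k - 2 - min (k - 3) ν),
            cycVar (2 ^ u) ^ (2 ^ (1 + min (k - 3) ν))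
  else
    2 ^ (k - 2 - ν) * cycVar 1 ^ (2 ^ (2 + ν))
        * ∏ u ∈ Finset.Icc 1 (k - 2 - ν), cycVar (2 ^ u) ^ (2 ^ (1 + ν))
      + ∑ v ∈ Finset.range (ν + 2),
          (Nat.totient (2 ^ (k - v)) : MvPolynomial ℕ+ ℚ) * cycVar (2 ^ (k - v)) ^ (2 ^ v)

/-- The polynomial `Γ_{p^k}(o)` for a prime `p` and `o ∈ Ω(p^k)`. The constructor `odd` is the case
`p > 2`, the constructor `two` is the case `p = 2`. All subtractions and divisions of natural
numbers in these formulas are exact for `o ∈ Ω(p^k)`, up to index ranges and exponents in products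
and sums that are empty anyway. -/
noncomputable def gammaPoly (p k : ℕ) : OrderDatum → MvPolynomial ℕ+ ℚ
  | .odd o => gammaOdd p k o
  | .two ε o' =>
    if k = 0 then cycVar 1
    else if k = 1 then cycVar 1 ^ 2 + cycVar 2
    else if k = 2 then gammaFour ε
    else gammaTwoPow k ε (k - 2 - padicValNat 2 o')

/-! ### Cycle types from counts of points of given period -/

section PermutationCycles

open Equiv.Perm Function

variable {Ω : Type*} [Fintype Ω]

/-! A cycle type is determined by the number of points of each period, so no cycle has to be
exhibited. For `g x = a x + b` the displacement is `c = g x - x = (a - 1) x + b`, and `g^n x - x =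
S_n * c` with `S_n = 1 + a + ⋯ + a^(n-1)`. Hence the period of `x` depends only on the additive
order of `c`, and two questions remain: how often each order occurs, and when `p^j ∣ S_n`.

Modulo `p^k`, write `a - 1 = p^s * unit`. If `p^(k-s)` kills `b`, displacements run `p^s`-to-one
over the `p^(k-s)`-torsion; otherwise every displacement has the order of `b`, and all cycles have
equal length. So the cycle type depends on `b` only through its order, and the sum over `b`
collapses to one over orders `p^j`, weighted by `φ(p^j)`.

Divisibility of `S_n` comes from lifting the exponent. If `p ∣ a - 1` (and `4 ∣ a - 1` when `p =
2`), then `p^j ∣ S_n ↔ p^j ∣ n`. If `p` is odd and `p ∤ a - 1`, one applies this to `a^d`, with `d`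
the order of `a` mod `p`. If `p = 2` and `4 ∣ a + 1`, one uses `S_{2m}(a) = (1 + a) S_m(a^2)`. The
valuations that enter are the ones recorded by the order datum.

For general `m`, the Chinese remainder theorem makes affine maps products of affine maps, and `⊛` is
the product of cycle types, so the cycle counter is multiplicative in `m`. -/

theorem Equiv.Perm.minimalPeriod_pos (g : Equiv.Perm Ω) (x : Ω) : 0 < minimalPeriod g x :=
  minimalPeriod_pos_of_mem_periodicPts (g.injective.mem_periodicPts x)

theorem minimalPeriod_eq_card_support_cycleOf [DecidableEq Ω] (g : Equiv.Perm Ω) {x : Ω}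
    (hx : g x ≠ x) : minimalPeriod g x = (g.cycleOf x).support.card := by
  refine Nat.dvd_right_iff_eq.mp fun n => ?_
  have hc := isCycle_cycleOf g hx
  rw [← hc.orderOf, ← isPeriodicPt_iff_minimalPeriod_dvd, orderOf_dvd_iff_pow_eq_one,
    hc.pow_eq_one_iff' (x := x) (by rwa [cycleOf_apply_self]), cycleOf_pow_apply_self,
    IsPeriodicPt, IsFixedPt, Equiv.Perm.iterate_eq_pow]

-- For `i ≥ 2`, the points of period `i` are the disjoint union of the supports of the cycle factors
-- of size `i`. The case `i = 1` is separate because `cycleType` omits fixed points.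
open Classical in
theorem mul_count_partition_eq_card_minimalPeriod (g : Equiv.Perm Ω) (i : ℕ) :
    i * g.partition.parts.count i = (Finset.univ.filter fun x => minimalPeriod g x = i).card := by
  rcases Nat.lt_trichotomy i 1 with hi | rfl | hi
  · obtain rfl : i = 0 := by omega
    rw [zero_mul, eq_comm, Finset.card_eq_zero, Finset.filter_eq_empty_iff]
    intro x _
    exact (g.minimalPeriod_pos x).ne'
  · have h1 : g.cycleType.count 1 = 0 :=
      Multiset.count_eq_zero.mpr fun h => absurd (two_le_of_mem_cycleType h) (by norm_num)
    rw [parts_partition, Multiset.count_add, h1, Multiset.count_replicate_self, one_mul, zero_add,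
      ← Finset.card_compl]
    congr 1
    ext x
    simp [minimalPeriod_eq_one_iff_isFixedPt, IsFixedPt]
  · have h1 : (Multiset.replicate (Fintype.card Ω - g.support.card) 1).count i = 0 :=
      Multiset.count_eq_zero.mpr fun h => absurd (Multiset.eq_of_mem_replicate h) (by omega)
    have h2 : (Finset.univ.filter fun x => minimalPeriod g x = i)
        = (g.cycleFactorsFinset.filter fun c => c.support.card = i).biUnion support := by
      ext x
      simp only [Finset.mem_filter, Finset.mem_univ, true_and, Finset.mem_biUnion]
      constructor
      · intro h
        have hx : g x ≠ x := fun hx => by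
          rw [minimalPeriod_eq_one_iff_isFixedPt.mpr hx] at h; omega
        refine ⟨g.cycleOf x, ⟨cycleOf_mem_cycleFactorsFinset_iff.mpr (Equiv.Perm.mem_support.mpr hx), ?_⟩, ?_⟩
        · rw [← minimalPeriod_eq_card_support_cycleOf g hx, h]
        · rw [Equiv.Perm.mem_support, cycleOf_apply_self]; exact hx
      · rintro ⟨c, ⟨hc, hi⟩, hx⟩
        have hgx : g x ≠ x := Equiv.Perm.mem_support.mp (mem_cycleFactorsFinset_support_le hc hx)
        rw [minimalPeriod_eq_card_support_cycleOf g hgx, ← cycle_is_cycleOf hx hc, hi]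
    rw [h2, Finset.card_biUnion]
    · rw [Finset.sum_congr rfl fun c hc => (Finset.mem_filter.mp hc).2, Finset.sum_const,
        smul_eq_mul, mul_comm, parts_partition, Multiset.count_add, h1, add_zero,
        cycleType_def, Multiset.count_map]
      simp only [Finset.card, Finset.filter_val, Function.comp_apply, eq_comm]
      congr
    · intro c hc d hd hcd
      exact (g.cycleFactorsFinset_pairwise_disjoint (Finset.mem_filter.mp hc).1
        (Finset.mem_filter.mp hd).1 hcd).disjoint_support

open Classical in
/-- The exponent vector of the cycle type of a permutation. -/
noncomputable def cycleExp (g : Equiv.Perm Ω) : ℕ+ →₀ ℕ :=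
  (g.partition.parts.map fun i => Finsupp.single i.toPNat' 1).sum

theorem cycleTypeMonomial_eq_monomial (g : Equiv.Perm Ω) :
    cycleTypeMonomial g = monomial (cycleExp g) 1 := by
  classical
  unfold cycleTypeMonomial cycleExp
  generalize g.partition.parts = P
  induction P using Multiset.induction_on with
  | empty => simp
  | cons a s ih =>
    simp only [Multiset.map_cons, Multiset.prod_cons, Multiset.sum_cons]
    rw [ih, cycVar, X, monomial_mul, one_mul]

/-- Multiplying by `i` turns cycle counts into point counts without division; every cycle type below
is computed through this. -/
theorem mul_cycleExp_apply (g : Equiv.Perm Ω) [DecidableEq Ω] (i : ℕ+) :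
    (i : ℕ) * cycleExp g i
      = (Finset.univ.filter fun x => minimalPeriod g x = (i : ℕ)).card := by
  classical
  have h : ∀ P : Multiset ℕ, (∀ n ∈ P, 0 < n) →
      (P.map fun n => Finsupp.single n.toPNat' 1).sum i = P.count (i : ℕ) := by
    intro P
    induction P using Multiset.induction_on with
    | empty => simp
    | cons a s ih =>
      intro hs
      have ha : 0 < a := hs a (Multiset.mem_cons_self a s)
      rw [Multiset.map_cons, Multiset.sum_cons, Finsupp.add_apply,
        ih fun n hn => hs n (Multiset.mem_cons_of_mem hn), Multiset.count_cons, add_comm,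
        Finsupp.single_apply]
      congr 1
      refine if_congr ?_ rfl rfl
      rw [← PNat.coe_inj, Nat.toPNat'_coe, if_pos ha, eq_comm]
  have h2 := mul_count_partition_eq_card_minimalPeriod g i
  rw [← h _ fun n hn => Nat.Partition.parts_pos _ hn] at h2
  unfold cycleExp
  convert h2

/-- A permutation whose points are sorted into classes `j ∈ J`, such that class `j` consists of
`ℓ j * e j` points of period `ℓ j`, has cycle type `∏ j ∈ J, x_{ℓ j} ^ e j`. -/
theorem cycleTypeMonomial_eq_prod {ι : Type*} [DecidableEq ι] (g : Equiv.Perm Ω) (J : Finset ι)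
    (ℓ e : ι → ℕ) (hℓ : ∀ j ∈ J, 0 < ℓ j) (κ : Ω → ι) (hκ : ∀ x, κ x ∈ J) (hper : ∀ x, minimalPeriod g x = ℓ (κ x))
    (hcard : ∀ j ∈ J, (Finset.univ.filter fun x => κ x = j).card = ℓ j * e j) :
    cycleTypeMonomial g = ∏ j ∈ J, cycVar (ℓ j) ^ e j := by
  classical
  have hR : ∏ j ∈ J, cycVar (ℓ j) ^ e j
      = monomial (∑ j ∈ J, Finsupp.single (ℓ j).toPNat' (e j)) (1 : ℚ) := by
    simp only [cycVar, X_pow_eq_monomial, monomial_sum_one]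
  rw [hR, cycleTypeMonomial_eq_monomial]
  refine congrArg (fun s => monomial s 1) (Finsupp.ext fun i => ?_)
  apply Nat.eq_of_mul_eq_mul_left i.pos
  rw [mul_cycleExp_apply, Finsupp.finsetSum_apply, Finset.mul_sum,
    Finset.card_eq_sum_card_fiberwise (f := κ) (t := J) fun x _ => hκ x]
  refine Finset.sum_congr rfl fun j hj => ?_
  have hi : (ℓ j).toPNat' = i ↔ ℓ j = i := by
    rw [← PNat.coe_inj, Nat.toPNat'_coe, if_pos (hℓ j hj)]
  rw [Finset.filter_filter, Finsupp.single_apply]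
  by_cases h : ℓ j = i
  · rw [if_pos (hi.mpr h), ← h, ← hcard _ hj]
    congr 1
    ext y
    simp only [Finset.mem_filter, Finset.mem_univ, true_and]
    exact ⟨fun h => h.2, fun h => ⟨by rw [hper, h], h⟩⟩
  · rw [if_neg (mt hi.mp h), mul_zero, Finset.card_eq_zero, Finset.filter_eq_empty_iff]
    rintro y - ⟨h1, h2⟩
    rw [hper, h2] at h1
    exact h h1

end PermutationCycles

/-! ### Product permutations and the product ⊛ -/

section StarProductOfCycleCounters

open Function

theorem Function.Semiconj.minimalPeriod_eq_of_injective {α β : Type*} {f : α → α} {g : β → β}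
    {e : α → β} (h : Semiconj e f g) (he : Injective e) (x : α) :
    minimalPeriod f x = minimalPeriod g (e x) := by
  refine Nat.dvd_right_iff_eq.mp fun n => ?_
  rw [← isPeriodicPt_iff_minimalPeriod_dvd, ← isPeriodicPt_iff_minimalPeriod_dvd, IsPeriodicPt,
    IsPeriodicPt, IsFixedPt, IsFixedPt, ← (h.iterate_right n).eq, he.eq_iff]

/-- The cycle type of a product permutation is the `⊛`-product of the cycle types. -/
theorem cycleTypeMonomial_prod {Ω Ω₁ Ω₂ : Type*} [Fintype Ω] [Fintype Ω₁] [Fintype Ω₂]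
    (e : Ω ≃ Ω₁ × Ω₂) (G : Equiv.Perm Ω) (g : Equiv.Perm Ω₁) (h : Equiv.Perm Ω₂)
    (hG : ∀ x, e (G x) = (g (e x).1, h (e x).2)) :
    cycleTypeMonomial G = starProduct (cycleTypeMonomial g) (cycleTypeMonomial h) := by
  classical
  rw [cycleTypeMonomial_eq_monomial g, cycleTypeMonomial_eq_monomial h, starProduct_monomial,
    one_mul, ← starMonomial_eq, starMonomial, ← Finset.prod_product',
    cycleTypeMonomial_eq_prod G ((cycleExp g).support ×ˢ (cycleExp h).support)
      (fun a => (PNat.lcm a.1 a.2 : ℕ))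
      (fun a => cycleExp g a.1 * cycleExp h a.2 * (PNat.gcd a.1 a.2 : ℕ))
      (fun a _ => PNat.pos _)
      (fun x => ((minimalPeriod g (e x).1).toPNat', (minimalPeriod h (e x).2).toPNat'))]
  · simp only [cycVar, PNat.coe_toPNat']
  · intro x
    simp only [Finset.mem_product, Finsupp.mem_support_iff]
    refine ⟨fun h0 => ?_, fun h0 => ?_⟩
    · have := mul_cycleExp_apply g (minimalPeriod g (e x).1).toPNat'
      rw [h0, mul_zero, eq_comm, Finset.card_eq_zero, Finset.filter_eq_empty_iff] at this
      exact this (Finset.mem_univ (e x).1) (by rw [Nat.toPNat'_coe, if_pos (g.minimalPeriod_pos _)])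
    · have := mul_cycleExp_apply h (minimalPeriod h (e x).2).toPNat'
      rw [h0, mul_zero, eq_comm, Finset.card_eq_zero, Finset.filter_eq_empty_iff] at this
      exact this (Finset.mem_univ (e x).2) (by rw [Nat.toPNat'_coe, if_pos (h.minimalPeriod_pos _)])
  · intro x
    have hs : Semiconj e G (Prod.map g h) := fun x => hG x
    rw [hs.minimalPeriod_eq_of_injective e.injective, minimalPeriod_prodMap, PNat.lcm_coe,
      Nat.toPNat'_coe, Nat.toPNat'_coe, if_pos (g.minimalPeriod_pos _), if_pos (h.minimalPeriod_pos _)]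
  · rintro ⟨a, b⟩ -
    have h1 : (Finset.univ.filter fun x =>
          ((minimalPeriod g (e x).1).toPNat', (minimalPeriod h (e x).2).toPNat') = (a, b)).card
        = ((Finset.univ.filter fun x => minimalPeriod g x = (a : ℕ)) ×ˢ
          (Finset.univ.filter fun x => minimalPeriod h x = (b : ℕ))).card := by
      refine Finset.card_equiv e fun x => ?_
      simp only [Finset.mem_filter, Finset.mem_univ, true_and, Finset.mem_product, Prod.mk.injEq,
        ← PNat.coe_inj, Nat.toPNat'_coe, if_pos (g.minimalPeriod_pos _), if_pos (h.minimalPeriod_pos _)]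
    rw [h1, Finset.card_product, ← mul_cycleExp_apply, ← mul_cycleExp_apply]
    -- The product of an `a`-cycle and a `b`-cycle has `ab` points of period `lcm(a,b)`, hence
    -- `gcd(a,b)` cycles.
    have h2 := congrArg PNat.val (PNat.gcd_mul_lcm a b)
    rw [PNat.mul_coe, PNat.mul_coe] at h2
    calc (a : ℕ) * cycleExp g a * (b * cycleExp h b)
        = (a * b) * (cycleExp g a * cycleExp h b) := by ring
      _ = _ := by rw [← h2]; ring

theorem starProduct_sum {R ι κ : Type*} [CommSemiring R] (s : Finset ι) (t : Finset κ)
    (f : ι → MvPolynomial ℕ+ R) (g : κ → MvPolynomial ℕ+ R) :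
    starProduct (∑ i ∈ s, f i) (∑ j ∈ t, g j) = ∑ i ∈ s, ∑ j ∈ t, starProduct (f i) (g j) := by
  have h0 : ∀ g : MvPolynomial ℕ+ R, starProduct 0 g = 0 := fun g => by simp [starProduct]
  have hl := map_sum (⟨⟨fun f => starProduct f (∑ j ∈ t, g j), h0 _⟩,
    fun f f' => starProduct_add_left f f' _⟩ : MvPolynomial ℕ+ R →+ MvPolynomial ℕ+ R) f s
  refine hl.trans (Finset.sum_congr rfl fun i _ => ?_)
  exact map_sum (⟨⟨fun g => starProduct (f i) g, by rw [starProduct_comm, h0]⟩,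
    fun g g' => starProduct_add_right _ g g'⟩ : MvPolynomial ℕ+ R →+ MvPolynomial ℕ+ R) g t

end StarProductOfCycleCounters

/-! ### Affine permutations and the Chinese remainder theorem -/

section AffinePermutations

/-- The affine permutation `x ↦ u x + b` of `ℤ/mℤ`. -/
def affinePerm {m : ℕ} (u : (ZMod m)ˣ) (b : ZMod m) : Equiv.Perm (ZMod m) :=
  u.mulLeft.trans (Equiv.addRight b)

theorem affinePerm_apply {m : ℕ} (u : (ZMod m)ˣ) (b x : ZMod m) :
    affinePerm u b x = u * x + b := rfl

theorem exists_unit_eq_intCast {m : ℕ} {a : ℤ} (ha : IsCoprime (m : ℤ) a) :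
    ∃ u : (ZMod m)ˣ, (u : ZMod m) = a := by
  obtain ⟨x, y, hxy⟩ := ha
  have h : (y : ZMod m) * a = 1 := by
    have := congrArg (Int.cast : ℤ → ZMod m) hxy
    push_cast at this
    simpa using this
  exact ⟨⟨a, y, by rw [mul_comm, h], h⟩, rfl⟩

theorem cycleCounter_holA_eq_sum {m : ℕ} [NeZero m] {a : ℤ} (u : (ZMod m)ˣ)
    (hu : (u : ZMod m) = a) :
    cycleCounter (holA m a) = ∑ b : ZMod m, cycleTypeMonomial (affinePerm u b) := by
  classical
  unfold cycleCounter
  symm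
  refine Finset.sum_bij (fun b _ => affinePerm u b) ?_ ?_ ?_ fun _ _ => ?_
  · intro b _
    simp only [Finset.mem_filter, Finset.mem_univ, true_and]
    exact ⟨b, fun x => by rw [affinePerm_apply, hu]⟩
  · intro b _ b' _ h
    simpa [affinePerm_apply] using congrArg (fun g => g 0) h
  · intro f hf
    obtain ⟨b, hb⟩ := (Finset.mem_filter.mp hf).2
    exact ⟨b, Finset.mem_univ b, Equiv.ext fun x => by rw [hb, affinePerm_apply, hu]⟩
  · congr

theorem holA_congr {m : ℕ} {a a' : ℤ} (h : (a : ZMod m) = a') : holA m a = holA m a' := by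
  unfold holA; rw [h]

/-- The Chinese remainder isomorphism splits each affine map into a pair with the same integer
multiplier `a`, and identifies the translations `b` with pairs; bilinearity of `⊛` does the rest. -/
theorem cycleCounter_holA_mul {m n : ℕ} [NeZero m] [NeZero n] (hmn : m.Coprime n) {a : ℤ}
    (ha : IsCoprime ((m * n : ℕ) : ℤ) a) :
    cycleCounter (holA (m * n) a)
      = starProduct (cycleCounter (holA m a)) (cycleCounter (holA n a)) := by
  have ha' := ha
  rw [Nat.cast_mul] at ha'
  obtain ⟨w, hw⟩ := exists_unit_eq_intCast ha
  obtain ⟨u, hu⟩ := exists_unit_eq_intCast ha'.of_mul_left_left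
  obtain ⟨v, hv⟩ := exists_unit_eq_intCast ha'.of_mul_left_right
  rw [cycleCounter_holA_eq_sum w hw, cycleCounter_holA_eq_sum u hu, cycleCounter_holA_eq_sum v hv,
    starProduct_sum, ← Finset.sum_product']
  let e := ZMod.chineseRemainder hmn
  refine Finset.sum_equiv e.toEquiv (fun _ => by simp) fun b _ => ?_
  refine cycleTypeMonomial_prod e.toEquiv _ _ _ fun x => ?_
  change e (w * x + b) = (u * (e x).1 + (e b).1, v * (e x).2 + (e b).2)
  rw [map_add, map_mul, hw, hu, hv, map_intCast]
  rfl

end AffinePermutations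

/-! ### Decomposition over all primes -/

section StarFinprod

theorem eq_finprod_primes_of_multiplicative {M : Type*} [CommMonoid M] (f : ℕ → M)
    (hmul : ∀ x y : ℕ, x.Coprime y → f (x * y) = f x * f y) (h1 : f 1 = 1) {m : ℕ} (hm : m ≠ 0) :
    f m = ∏ᶠ p : Nat.Primes, f (p ^ padicValNat p m) := by
  rw [Nat.multiplicative_factorization f hmul h1 hm]
  have hfac : ∀ p : Nat.Primes, m.factorization p = padicValNat p m := fun p =>
    Nat.factorization_def m p.2
  let ι : {p // p ∈ m.primeFactors} ↪ Nat.Primes :=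
    ⟨fun p => ⟨p, Nat.prime_of_mem_primeFactors p.2⟩, fun p q h => Subtype.ext (congrArg
      (fun r : Nat.Primes => (r : ℕ)) h)⟩
  have hs : (Function.mulSupport fun p : Nat.Primes => f (p ^ padicValNat p m)) ⊆
      (m.primeFactors.attach.map ι : Finset Nat.Primes) := by
    intro p hp
    have hq : (p : ℕ) ∈ m.primeFactors := by
      by_contra hq
      rw [← Nat.support_factorization, Finsupp.notMem_support_iff, hfac p] at hq
      exact hp (by simp only [hq, pow_zero, h1])
    exact Finset.mem_map.mpr ⟨⟨p, hq⟩, Finset.mem_attach _ _, rfl⟩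
  rw [finprod_eq_prod_of_mulSupport_subset _ hs, Finsupp.prod, Nat.support_factorization,
    Finset.prod_map, ← Finset.prod_attach]
  exact Finset.prod_congr rfl fun p _ => by rw [← hfac (ι p)]; rfl

theorem cycleCounter_holA_one (a : ℤ) : cycleCounter (holA 1 a) = X 1 := by
  obtain ⟨u, hu⟩ := exists_unit_eq_intCast (m := 1) (a := a) (by simpa using isCoprime_one_left)
  rw [cycleCounter_holA_eq_sum u hu, Fintype.sum_unique,
    cycleTypeMonomial_eq_prod _ {()} (fun _ => 1) (fun _ => 1) (by simp) (fun _ => ()) (by simp)]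
  · rw [Finset.prod_singleton, pow_one]; rfl
  · intro x
    exact Function.minimalPeriod_eq_one_iff_isFixedPt.mpr (Subsingleton.elim _ _)
  · simp

/-- The cycle counter of `Hol_a(ℤ/mℤ)` is the `⊛`-product of its primary parts. -/
theorem cycleCounter_holA_eq_starFinprod {m : ℕ} [NeZero m] {a : ℤ} (ha : IsCoprime (m : ℤ) a)
    (F : Nat.Primes → MvPolynomial ℕ+ ℚ)
    (hF : ∀ (p : Nat.Primes) [NeZero ((p : ℕ) ^ padicValNat p m)],
      cycleCounter (holA (p ^ padicValNat p m) a) = F p) :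
    cycleCounter (holA m a) = starFinprod F := by
  classical
  -- Extension by zero makes `f` multiplicative on all coprime pairs: if a factor is zero or not
  -- coprime to `a`, so is the product, and both sides vanish.
  let f : ℕ → MvPolynomial ℕ+ ℚ := fun n =>
    if h : n ≠ 0 ∧ IsCoprime (n : ℤ) a then
      haveI : NeZero n := ⟨h.1⟩
      cycleCounter (holA n a)
    else 0
  have hf : ∀ (n : ℕ) [NeZero n], IsCoprime (n : ℤ) a → f n = cycleCounter (holA n a) := fun n _ h =>
    dif_pos ⟨NeZero.ne n, h⟩
  have h0 : ∀ g : MvPolynomial ℕ+ ℚ, starProduct 0 g = 0 := fun g => by simp [starProduct]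
  have hmul : ∀ x y : ℕ, x.Coprime y → f (x * y) = starProduct (f x) (f y) := by
    intro x y hxy
    by_cases hx : x ≠ 0 ∧ IsCoprime (x : ℤ) a
    · by_cases hy : y ≠ 0 ∧ IsCoprime (y : ℤ) a
      · have : NeZero x := ⟨hx.1⟩
        have : NeZero y := ⟨hy.1⟩
        have hxya : IsCoprime ((x * y : ℕ) : ℤ) a := by
          rw [Nat.cast_mul]; exact hx.2.mul_left hy.2
        rw [hf x hx.2, hf y hy.2, hf (x * y) hxya, cycleCounter_holA_mul hxy hxya]
      · have h1 : f y = 0 := dif_neg hy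
        rw [h1, starProduct_comm, h0]
        refine dif_neg fun h => hy ⟨right_ne_zero_of_mul h.1, ?_⟩
        have h2 := h.2
        rw [Nat.cast_mul] at h2
        exact h2.of_mul_left_right
    · have h1 : f x = 0 := dif_neg hx
      rw [h1, h0]
      refine dif_neg fun h => hx ⟨left_ne_zero_of_mul h.1, ?_⟩
      have h2 := h.2
      rw [Nat.cast_mul] at h2
      exact h2.of_mul_left_left
  have h1 : f 1 = X 1 := by
    rw [hf 1 (by simpa using isCoprime_one_left), cycleCounter_holA_one]
  rw [← hf m ha]
  -- The monoid structure is passed explicitly, since the polynomial ring already carries its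
  -- ordinary product.
  refine (@eq_finprod_primes_of_multiplicative _ (starCommMonoid ℚ) f hmul h1 m
    (NeZero.ne m)).trans ?_
  unfold starFinprod
  congr 1
  funext p
  have : NeZero ((p : ℕ) ^ padicValNat p m) := ⟨pow_ne_zero _ p.2.ne_zero⟩
  rw [hf, hF]
  exact ha.of_isCoprime_of_dvd_left (Int.natCast_dvd_natCast.mpr pow_padicValNat_dvd)

end StarFinprod

/-! ### Counting elements of given additive order -/

section CyclicGroupCounts

theorem addOrderOf_natCast_dvd_iff_intCast_mul_eq_zero {m : ℕ} (c : ZMod m) (z : ℤ) :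
    (addOrderOf c : ℤ) ∣ z ↔ (z : ZMod m) * c = 0 := by
  rw [addOrderOf_dvd_iff_zsmul_eq_zero, zsmul_eq_mul]

theorem ZMod.card_nsmul_eq_zero {m d : ℕ} [NeZero m] (hd : d ∣ m) :
    (Finset.univ.filter fun z : ZMod m => d • z = 0).card = d := by
  classical
  have hd0 : d ≠ 0 := fun h => NeZero.ne m (Nat.eq_zero_of_zero_dvd (h ▸ hd))
  rw [Finset.card_eq_sum_card_fiberwise (f := addOrderOf) (t := d.divisors) fun z hz => ?_]
  · conv_rhs => rw [← Nat.sum_totient d]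
    refine Finset.sum_congr rfl fun e he => ?_
    have hed := Nat.dvd_of_mem_divisors he
    rw [← IsAddCyclic.card_addOrderOf_eq_totient (α := ZMod m) (d := e)
      (by rw [ZMod.card]; exact hed.trans hd), Finset.filter_filter]
    congr 1
    ext z
    simp only [Finset.mem_filter, Finset.mem_univ, true_and, and_iff_right_iff_imp]
    rintro rfl
    exact addOrderOf_dvd_iff_nsmul_eq_zero.mp hed
  · simp only [Finset.coe_filter, Finset.mem_univ, true_and, Set.mem_ofPred_eq] at hz
    exact Nat.mem_divisors.mpr ⟨addOrderOf_dvd_iff_nsmul_eq_zero.mpr hz, hd0⟩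

theorem ZMod.exists_eq_mul_of_nsmul_eq_zero {d e : ℕ} [NeZero (d * e)] {c : ZMod (d * e)}
    (hc : e • c = 0) : ∃ y : ZMod (d * e), c = d * y := by
  have he : 0 < e := Nat.pos_of_ne_zero (right_ne_zero_of_mul (NeZero.ne (d * e)))
  rw [← ZMod.natCast_zmod_val c, nsmul_eq_mul, ← Nat.cast_mul, ZMod.natCast_eq_zero_iff] at hc
  obtain ⟨y, hy⟩ := Nat.dvd_of_mul_dvd_mul_left he ((dvd_of_eq (mul_comm e d)).trans hc)
  exact ⟨y, by rw [← Nat.cast_mul, ← hy, ZMod.natCast_zmod_val]⟩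

/-- For a unit `w` of `ℤ/deℤ`, the map `x ↦ d w x + b` is `d`-to-one onto the `e`-torsion,
provided that `b` is `e`-torsion. -/
theorem ZMod.card_addOrderOf_affine {d e f : ℕ} [NeZero (d * e)] {w b : ZMod (d * e)}
    (hw : IsUnit w) (hb : e • b = 0) (hf : f ∣ e) :
    (Finset.univ.filter fun x : ZMod (d * e) => addOrderOf (d * w * x + b) = f).card
      = d * f.totient := by
  classical
  rw [Finset.card_eq_sum_card_fiberwise (f := fun x => d * w * x + b)
    (t := Finset.univ.filter fun c : ZMod (d * e) => addOrderOf c = f) fun x hx => by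
      simpa using hx]
  rw [Finset.sum_congr rfl fun c hc => ?_, Finset.sum_const, smul_eq_mul,
    IsAddCyclic.card_addOrderOf_eq_totient (by rw [ZMod.card]; exact hf.trans (dvd_mul_left _ _)),
    mul_comm]
  have hc' : addOrderOf c = f := (Finset.mem_filter.mp hc).2
  have hec : e • c = 0 := addOrderOf_dvd_iff_nsmul_eq_zero.mp (hc' ▸ hf)
  obtain ⟨y, hy⟩ := ZMod.exists_eq_mul_of_nsmul_eq_zero (c := c - b) (by
    rw [nsmul_sub, hec, hb, sub_zero])
  obtain ⟨w, rfl⟩ := hw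
  have h1 := ZMod.card_nsmul_eq_zero (m := d * e) (dvd_mul_right d e)
  rw [Finset.filter_filter]
  refine Eq.trans ?_ h1
  -- As `c - b = d y`, the map `x ↦ w x - y` identifies the fibre over `c` with the `d`-torsion.
  refine Finset.card_equiv (w.mulLeft.trans (Equiv.subRight y)) fun x => ?_
  simp only [Finset.mem_filter, Finset.mem_univ, true_and, Equiv.trans_apply, Units.mulLeft_apply,
    Equiv.subRight_apply, nsmul_eq_mul, mul_sub, ← hy]
  constructor
  · rintro ⟨-, rfl⟩; ring
  · intro h
    have : d * ↑w * x + b = c := by linear_combination h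
    exact ⟨by rw [this, hc'], this⟩

theorem ZMod.exists_addOrderOf_eq_prime_pow {p k : ℕ} [hp : Fact p.Prime] (c : ZMod (p ^ k)) :
    ∃ j ≤ k, addOrderOf c = p ^ j := by
  refine (Nat.dvd_prime_pow hp.out).mp ?_
  have := addOrderOf_dvd_card (x := c)
  rwa [ZMod.card] at this

theorem ZMod.sum_addOrderOf {p k : ℕ} [hp : Fact p.Prime] {R : Type*} [CommSemiring R]
    (F : ℕ → R) :
    ∑ b : ZMod (p ^ k), F (addOrderOf b)
      = ∑ j ∈ Finset.range (k + 1), (Nat.totient (p ^ j) : R) * F (p ^ j) := by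
  classical
  rw [← Finset.sum_fiberwise_of_maps_to (g := addOrderOf) (t := (p ^ k).divisors) fun b _ => ?_,
    Nat.sum_divisors_prime_pow hp.out]
  · refine Finset.sum_congr rfl fun j hj => ?_
    rw [Finset.sum_congr rfl fun b hb => by rw [(Finset.mem_filter.mp hb).2], Finset.sum_const,
      IsAddCyclic.card_addOrderOf_eq_totient, nsmul_eq_mul]
    rw [ZMod.card]
    exact pow_dvd_pow p (Nat.lt_succ_iff.mp (Finset.mem_range.mp hj))
  · obtain ⟨j, hj, h⟩ := ZMod.exists_addOrderOf_eq_prime_pow b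
    rw [h, Nat.mem_divisors]
    exact ⟨pow_dvd_pow p hj, pow_ne_zero _ hp.out.ne_zero⟩

/-- An ultrametric principle: the torsion subgroups form a chain, so adding an element of a term
that does not contain `b` leaves the order of `b` unchanged. -/
theorem ZMod.addOrderOf_add_eq_of_nsmul_eq_zero {p k t : ℕ} [hp : Fact p.Prime]
    {b y : ZMod (p ^ k)} (hy : p ^ t • y = 0) (hb : p ^ t • b ≠ 0) :
    addOrderOf (y + b) = addOrderOf b := by
  have key : ∀ n, p ^ n • (y + b) = 0 ↔ p ^ n • b = 0 := by
    intro n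
    rcases le_total t n with h | h
    · obtain ⟨r, rfl⟩ := Nat.exists_eq_add_of_le h
      rw [nsmul_add, pow_add, mul_comm, mul_smul, hy, smul_zero, zero_add]
    · obtain ⟨r, rfl⟩ := Nat.exists_eq_add_of_le h
      have hz : ∀ c : ZMod (p ^ k), p ^ n • c = 0 → p ^ (n + r) • c = 0 := fun c hc => by
        rw [pow_add, mul_comm, mul_smul, hc, smul_zero]
      refine ⟨fun h0 => absurd ?_ hb, fun h0 => absurd (hz b h0) hb⟩
      have := hz _ h0
      rwa [nsmul_add, hy, zero_add] at this
  obtain ⟨i, -, hi⟩ := ZMod.exists_addOrderOf_eq_prime_pow (y + b)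
  obtain ⟨j, -, hj⟩ := ZMod.exists_addOrderOf_eq_prime_pow b
  apply Nat.dvd_antisymm
  · rw [hj, addOrderOf_dvd_iff_nsmul_eq_zero, key, ← hj]; exact addOrderOf_nsmul_eq_zero b
  · rw [hi, addOrderOf_dvd_iff_nsmul_eq_zero, ← key, ← hi]; exact addOrderOf_nsmul_eq_zero _

end CyclicGroupCounts

/-! ### Cycle type of a single affine permutation -/

section AffineCycleTypes

open Function

/-- Each step multiplies the displacement by `u`, so the total displacement is a geometric sum times
the first one. -/
theorem affinePerm_iterate_sub {m : ℕ} (u : (ZMod m)ˣ) (b x : ZMod m) (n : ℕ) :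
    (affinePerm u b)^[n] x - x
      = (∑ i ∈ Finset.range n, (u : ZMod m) ^ i) * (((u : ZMod m) - 1) * x + b) := by
  induction n with
  | zero => simp
  | succ n ih =>
    have hg := mul_neg_geom_sum (u : ZMod m) n
    rw [Function.iterate_succ_apply', affinePerm_apply, Finset.sum_range_succ]
    rw [sub_eq_iff_eq_add] at ih
    rw [ih]
    linear_combination (-((u - 1) * x + b)) * hg

/-- The period of `x` is read off from the order `q` of its displacement; the integer lift `a` makes
valuation arguments available for the geometric sums. -/
theorem minimalPeriod_affinePerm {m : ℕ} {a : ℤ} {u : (ZMod m)ˣ} (hu : (u : ZMod m) = a)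
    (b x : ZMod m) {q ℓ : ℕ} (hq : addOrderOf (((a : ZMod m) - 1) * x + b) = q)
    (hℓ : ∀ n : ℕ, (q : ℤ) ∣ ∑ i ∈ Finset.range n, a ^ i ↔ ℓ ∣ n) :
    minimalPeriod (affinePerm u b) x = ℓ := by
  refine Nat.dvd_right_iff_eq.mp fun n => ?_
  rw [← isPeriodicPt_iff_minimalPeriod_dvd, ← hℓ, ← hq,
    addOrderOf_natCast_dvd_iff_intCast_mul_eq_zero, IsPeriodicPt, IsFixedPt, ← sub_eq_zero,
    affinePerm_iterate_sub, hu]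
  push_cast
  rfl

variable {p k s : ℕ} [hp : Fact p.Prime] {a : ℤ} {u : (ZMod (p ^ k))ˣ} {w b : ZMod (p ^ k)}

/-- Exactly `p^s φ(p^j)` points have displacement of order `p^j`; they have period `ℓ j` and so form
`e j` cycles. -/
theorem cycleTypeMonomial_affinePerm_of_torsion (hu : (u : ZMod (p ^ k)) = a) (hs : s ≤ k)
    (hw : IsUnit w) (ha : (a : ZMod (p ^ k)) - 1 = (p ^ s : ℕ) * w) (hb : p ^ (k - s) • b = 0)
    (ℓ e : ℕ → ℕ)
    (hℓ : ∀ j ≤ k - s, ∀ n : ℕ, ((p ^ j : ℕ) : ℤ) ∣ ∑ i ∈ Finset.range n, a ^ i ↔ ℓ j ∣ n)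
    (he : ∀ j ≤ k - s, ℓ j * e j = p ^ s * (p ^ j).totient) :
    cycleTypeMonomial (affinePerm u b)
      = ∏ j ∈ Finset.range (k - s + 1), cycVar (ℓ j) ^ e j := by
  have hpk : p ^ k = p ^ s * p ^ (k - s) := by rw [← pow_add, Nat.add_sub_cancel' hs]
  have hord : ∀ x : ZMod (p ^ k), ∃ j ≤ k - s,
      addOrderOf (((a : ZMod (p ^ k)) - 1) * x + b) = p ^ j := by
    intro x
    refine (Nat.dvd_prime_pow hp.out).mp (addOrderOf_dvd_iff_nsmul_eq_zero.mpr ?_)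
    rw [nsmul_add, hb, add_zero, ha, nsmul_eq_mul]
    calc ((p ^ (k - s) : ℕ) : ZMod (p ^ k)) * ((p ^ s : ℕ) * w * x)
        = ((p ^ s * p ^ (k - s) : ℕ) : ZMod (p ^ k)) * (w * x) := by
          rw [Nat.cast_mul]; ring
      _ = 0 := by rw [← hpk, ZMod.natCast_self, zero_mul]
  choose κ hκ hκ' using hord
  have hcard : ∀ j ≤ k - s, (Finset.univ.filter fun x => κ x = j).card = ℓ j * e j := by
    intro j hj
    -- The modulus is a free variable `N` so that it can be replaced by the factored form inside the
    -- dependent type `ZMod N`.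
    have h1 : ∀ (N : ℕ) [NeZero N] (hN : N = p ^ s * p ^ (k - s)) (w b : ZMod N),
        IsUnit w → p ^ (k - s) • b = 0 →
        (Finset.univ.filter fun x => addOrderOf ((p ^ s : ℕ) * w * x + b) = p ^ j).card
          = p ^ s * (p ^ j).totient := by
      rintro N _ rfl w b hw hb
      exact ZMod.card_addOrderOf_affine hw hb (pow_dvd_pow p hj)
    rw [he j hj, ← h1 _ hpk w b hw hb]
    congr 1
    ext x
    simp only [Finset.mem_filter, Finset.mem_univ, true_and]
    rw [← ha, hκ', Nat.pow_right_inj hp.out.two_le]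
  refine cycleTypeMonomial_eq_prod _ _ ℓ e (fun j hj => ?_) κ
    (fun x => Finset.mem_range.mpr (Nat.lt_succ_of_le (hκ x))) (fun x => ?_) fun j hj => ?_
  · refine Nat.pos_of_ne_zero fun h0 => ?_
    have := he j (Nat.lt_succ_iff.mp (Finset.mem_range.mp hj))
    rw [h0, zero_mul, eq_comm, Nat.mul_eq_zero] at this
    rcases this with h | h
    · exact pow_ne_zero _ hp.out.ne_zero h
    · exact (Nat.totient_pos.mpr (pow_pos hp.out.pos j)).ne' h
  · exact minimalPeriod_affinePerm hu b x (hκ' x) (hℓ _ (hκ x))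
  · exact hcard j (Nat.lt_succ_iff.mp (Finset.mem_range.mp hj))

/-- Here `p^(k-s)` kills `(a - 1) x` but not `b`, so every displacement has the order of `b`. -/
theorem cycleTypeMonomial_affinePerm_of_not_torsion (hu : (u : ZMod (p ^ k)) = a) (hs : s ≤ k)
    (ha : (a : ZMod (p ^ k)) - 1 = (p ^ s : ℕ) * w) (hb : p ^ (k - s) • b ≠ 0) {ℓ e : ℕ}
    (hℓ : ∀ n : ℕ, (addOrderOf b : ℤ) ∣ ∑ i ∈ Finset.range n, a ^ i ↔ ℓ ∣ n)
    (he : ℓ * e = p ^ k) :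
    cycleTypeMonomial (affinePerm u b) = cycVar ℓ ^ e := by
  have hpk : p ^ k = p ^ s * p ^ (k - s) := by rw [← pow_add, Nat.add_sub_cancel' hs]
  rw [cycleTypeMonomial_eq_prod _ {()} (fun _ => ℓ) (fun _ => e) _ (fun _ => ()) (by simp),
    Finset.prod_singleton]
  · intro x
    refine minimalPeriod_affinePerm hu b x ?_ hℓ
    refine ZMod.addOrderOf_add_eq_of_nsmul_eq_zero (t := k - s) ?_ hb
    rw [ha, nsmul_eq_mul]
    calc ((p ^ (k - s) : ℕ) : ZMod (p ^ k)) * ((p ^ s : ℕ) * w * x)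
        = ((p ^ s * p ^ (k - s) : ℕ) : ZMod (p ^ k)) * (w * x) := by
          rw [Nat.cast_mul]; ring
      _ = 0 := by rw [← hpk, ZMod.natCast_self, zero_mul]
  · simp [he, ZMod.card]
  · intro _ _
    refine Nat.pos_of_ne_zero fun h0 => ?_
    rw [h0, zero_mul] at he
    exact pow_ne_zero _ hp.out.ne_zero he.symm

end AffineCycleTypes

/-! ### Divisibility of geometric sums -/

section LiftingTheExponent

variable {p : ℕ} [hp : Fact p.Prime]

/-- Lifting the exponent gives `v(a^n - 1) = v(a - 1) + v(n)`; cancelling `v(a - 1)` leaves `v(S_n)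
= v(n)`. For `a = 1` that valuation is infinite, but `S_n = n`. -/
theorem prime_pow_dvd_geom_sum_iff {a : ℤ} (h1 : (p : ℤ) ∣ a - 1) (h2 : p = 2 → 4 ∣ a - 1)
    (j n : ℕ) : ((p ^ j : ℕ) : ℤ) ∣ ∑ i ∈ Finset.range n, a ^ i ↔ p ^ j ∣ n := by
  by_cases ha1 : a = 1
  · subst ha1
    simp only [one_pow, Finset.sum_const, Finset.card_range, nsmul_eq_mul, mul_one]
    exact Int.natCast_dvd_natCast
  have hpZ : Prime (p : ℤ) := Nat.prime_iff_prime_int.mp hp.out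
  have hpa : ¬ (p : ℤ) ∣ a := fun h => hpZ.not_dvd_one (by simpa using dvd_sub h h1)
  have hlte : emultiplicity (p : ℤ) (a ^ n - 1 ^ n)
      = emultiplicity (p : ℤ) (a - 1) + emultiplicity (p : ℤ) (n : ℤ) := by
    rcases hp.out.eq_two_or_odd' with rfl | hodd
    · exact Int.two_pow_sub_pow' n (h2 rfl) hpa
    · rw [Int.emultiplicity_pow_sub_pow hp.out hodd h1 hpa, Int.natCast_emultiplicity]
  rw [one_pow, ← mul_geom_sum, emultiplicity_mul hpZ] at hlte
  have hfin : FiniteMultiplicity (p : ℤ) (a - 1) := by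
    rw [Int.finiteMultiplicity_iff]
    exact ⟨by simpa using hp.out.ne_one, sub_ne_zero.mpr ha1⟩
  have heq := ENat.add_right_injective_of_ne_top
    (finiteMultiplicity_iff_emultiplicity_ne_top.mp hfin) hlte
  rw [Nat.cast_pow, pow_dvd_iff_le_emultiplicity, heq, ← pow_dvd_iff_le_emultiplicity]
  exact_mod_cast Int.natCast_dvd_natCast (m := p ^ j) (n := n)

/-- Here `s = min(v_p(c), k)`. The cap treats `c` divisible by `p^k`, including `c = 0`, uniformly
with the rest. -/
theorem exists_capped_valuation (c : ℤ) (k : ℕ) :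
    ∃ s ≤ k, (∃ w : ZMod (p ^ k), IsUnit w ∧ (c : ZMod (p ^ k)) = (p ^ s : ℕ) * w) ∧
      ∀ j ≤ k, ∀ T : ℤ, ((p ^ j : ℕ) : ℤ) ∣ c * T ↔ ((p ^ (j - s) : ℕ) : ℤ) ∣ T := by
  have hpZ : Prime (p : ℤ) := Nat.prime_iff_prime_int.mp hp.out
  by_cases hc : ((p ^ k : ℕ) : ℤ) ∣ c
  · refine ⟨k, le_rfl, ⟨1, isUnit_one, ?_⟩, fun j hj T => ?_⟩
    · rw [(ZMod.intCast_zmod_eq_zero_iff_dvd _ _).mpr hc, ZMod.natCast_self, zero_mul]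
    · rw [Nat.sub_eq_zero_of_le hj, pow_zero, Nat.cast_one]
      exact iff_of_true (((Int.natCast_dvd_natCast.mpr (pow_dvd_pow p hj)).trans hc).mul_right T)
        (one_dvd T)
  · have hc0 : c ≠ 0 := fun h => hc (h ▸ dvd_zero _)
    have hfin : FiniteMultiplicity (p : ℤ) c := by
      rw [Int.finiteMultiplicity_iff]
      exact ⟨by simpa using hp.out.ne_one, hc0⟩
    obtain ⟨W, hW, hpW⟩ := hfin.exists_eq_pow_mul_and_not_dvd
    generalize multiplicity (p : ℤ) c = s at hW
    have hsk : s < k := by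
      by_contra hks
      exact hc (hW ▸ (by rw [Nat.cast_pow]; exact (pow_dvd_pow _ (not_lt.mp hks)).mul_right W))
    have hcop : IsCoprime (p : ℤ) W := (Prime.coprime_iff_not_dvd hpZ).mpr hpW
    refine ⟨s, hsk.le, ⟨W, ?_, ?_⟩, fun j hj T => ?_⟩
    · obtain ⟨u, hu⟩ := exists_unit_eq_intCast (m := p ^ k) (a := W) (by
        rw [Nat.cast_pow]; exact hcop.pow_left)
      exact ⟨u, hu⟩
    · rw [hW]; push_cast; rfl
    · rw [hW, Nat.cast_pow, Nat.cast_pow, mul_assoc]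
      rcases le_total j s with h | h
      · rw [Nat.sub_eq_zero_of_le h, pow_zero]
        exact iff_of_true ((pow_dvd_pow _ h).mul_right _) (one_dvd T)
      · obtain ⟨r, rfl⟩ := Nat.exists_eq_add_of_le h
        rw [pow_add, mul_dvd_mul_iff_left (pow_ne_zero _ hpZ.ne_zero), Nat.add_sub_cancel_left]
        exact ⟨fun h => hcop.pow_left.dvd_of_dvd_mul_left h, fun h => h.mul_left W⟩

theorem le_of_forall_prime_pow_dvd_mul_iff {c : ℤ} {s k i : ℕ} (hi : i ≤ k)
    (h : ∀ j ≤ k, ∀ T : ℤ, ((p ^ j : ℕ) : ℤ) ∣ c * T ↔ ((p ^ (j - s) : ℕ) : ℤ) ∣ T)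
    (hc : ((p ^ i : ℕ) : ℤ) ∣ c) : i ≤ s := by
  have h1 := (h i hi 1).mp (by rwa [mul_one])
  have h2 : p ^ (i - s) ∣ 1 := by exact_mod_cast h1
  by_contra hlt
  exact (Nat.one_lt_pow (by omega) hp.out.one_lt).ne' (Nat.dvd_one.mp h2)

theorem ZMod.intCast_pow_eq_one_iff (m : ℕ) (a : ℤ) (n : ℕ) :
    (a : ZMod m) ^ n = 1 ↔ (m : ℤ) ∣ (a - 1) * ∑ i ∈ Finset.range n, a ^ i := by
  rw [mul_geom_sum, ← ZMod.intCast_zmod_eq_zero_iff_dvd]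
  push_cast
  rw [sub_eq_zero]

theorem orderOf_eq_of_geom_sum_dvd_iff {p : ℕ} {a : ℤ} {s k : ℕ}
    (h : ∀ j ≤ k, ∀ T : ℤ, ((p ^ j : ℕ) : ℤ) ∣ (a - 1) * T ↔ ((p ^ (j - s) : ℕ) : ℤ) ∣ T)
    (hS : ∀ j n : ℕ, ((p ^ j : ℕ) : ℤ) ∣ ∑ i ∈ Finset.range n, a ^ i ↔ p ^ j ∣ n) :
    orderOf (a : ZMod (p ^ k)) = p ^ (k - s) := by
  refine Nat.dvd_right_iff_eq.mp fun n => ?_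
  rw [orderOf_dvd_iff_pow_eq_one, ZMod.intCast_pow_eq_one_iff, h k le_rfl, hS]

end LiftingTheExponent

/-! ### Reindexing and totient sums -/

section Products

theorem Finset.prod_Icc_eq_prod_range {M : Type*} [CommMonoid M] (f : ℕ → M) (a n : ℕ) :
    ∏ u ∈ Finset.Icc a n, f u = ∏ i ∈ Finset.range (n + 1 - a), f (a + i) := by
  rw [← Finset.prod_Ico_eq_prod_range]
  rfl

theorem sum_totient_prime_pow {p : ℕ} (hp : p.Prime) (n : ℕ) :
    ∑ j ∈ Finset.range (n + 1), (p ^ j).totient = p ^ n := by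
  rw [← Nat.sum_divisors_prime_pow hp, Nat.sum_totient]

end Products

/-! ### Prime powers: the unipotent case and the case p ∤ a - 1 -/

section PrimePowerCycleCounters

variable {p k s : ℕ} [hp : Fact p.Prime] {a : ℤ}

theorem cycleCounter_holA_of_unipotent (hs : s ≤ k) (hs1 : 1 ≤ s)
    (hcop : IsCoprime ((p ^ k : ℕ) : ℤ) a)
    (hw : ∃ w : ZMod (p ^ k), IsUnit w ∧ ((a - 1 : ℤ) : ZMod (p ^ k)) = (p ^ s : ℕ) * w)
    (hS : ∀ j n : ℕ, ((p ^ j : ℕ) : ℤ) ∣ ∑ i ∈ Finset.range n, a ^ i ↔ p ^ j ∣ n) :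
    cycleCounter (holA (p ^ k) a)
      = ((p ^ (k - s) : ℕ) : MvPolynomial ℕ+ ℚ) * cycVar 1 ^ (p ^ s)
          * ∏ v ∈ Finset.Icc 1 (k - s), cycVar (p ^ v) ^ (p ^ (s - 1) * (p - 1))
        + ∑ v ∈ Finset.range s,
            ((p ^ (k - v)).totient : MvPolynomial ℕ+ ℚ) * cycVar (p ^ (k - v)) ^ (p ^ v) := by
  obtain ⟨u, hu⟩ := exists_unit_eq_intCast hcop
  obtain ⟨w, hw, ha⟩ := hw
  rw [Int.cast_sub, Int.cast_one] at ha
  have hp1 := hp.out.one_lt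
  let A : MvPolynomial ℕ+ ℚ := cycVar 1 ^ (p ^ s)
    * ∏ v ∈ Finset.Icc 1 (k - s), cycVar (p ^ v) ^ (p ^ (s - 1) * (p - 1))
  -- The cycle type as a function of the order `q` of `b` alone. All `p^(k-s)` torsion translations
  -- share the type `A`.
  let F : ℕ → MvPolynomial ℕ+ ℚ := fun q =>
    if q ∣ p ^ (k - s) then A else cycVar q ^ (p ^ k / q)
  have hF : ∀ b : ZMod (p ^ k), cycleTypeMonomial (affinePerm u b) = F (addOrderOf b) := by
    intro b
    by_cases hb : p ^ (k - s) • b = 0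
    · have hF : F (addOrderOf b) = A := if_pos (addOrderOf_dvd_iff_nsmul_eq_zero.mpr hb)
      rw [hF, cycleTypeMonomial_affinePerm_of_torsion hu hs hw ha hb (fun j => p ^ j)
        (fun j => if j = 0 then p ^ s else p ^ (s - 1) * (p - 1)) (fun j _ n => hS j n),
        Finset.prod_range_succ', Finset.prod_congr rfl fun j _ => by
          rw [if_neg (Nat.succ_ne_zero j)]]
      · change _ = cycVar 1 ^ (p ^ s) * _
        rw [Finset.prod_Icc_eq_prod_range, mul_comm, if_pos rfl, pow_zero, Nat.add_sub_cancel]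
        simp only [add_comm 1]
      · intro j _
        rcases Nat.eq_zero_or_pos j with rfl | hj
        · simp
        · rw [if_neg hj.ne', Nat.totient_prime_pow hp.out hj]
          obtain ⟨s, rfl⟩ := Nat.exists_eq_add_of_le' hs1
          obtain ⟨j, rfl⟩ := Nat.exists_eq_add_of_le' hj
          simp only [Nat.add_sub_cancel, pow_succ]; ring
    · have hF : F (addOrderOf b) = cycVar (addOrderOf b) ^ (p ^ k / addOrderOf b) :=
        if_neg (mt addOrderOf_dvd_iff_nsmul_eq_zero.mp hb)
      obtain ⟨j, hj, hbj⟩ := ZMod.exists_addOrderOf_eq_prime_pow b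
      rw [hF, cycleTypeMonomial_affinePerm_of_not_torsion hu hs ha hb (fun n => ?_)]
      · rw [hbj]; exact Nat.mul_div_cancel' (pow_dvd_pow p hj)
      · rw [hbj]; exact hS j n
  rw [cycleCounter_holA_eq_sum u hu, Finset.sum_congr rfl fun b _ => hF b, ZMod.sum_addOrderOf]
  have hks : k + 1 = (k - s + 1) + s := by omega
  rw [hks, Finset.sum_range_add]
  congr 1
  · rw [mul_assoc, ← sum_totient_prime_pow hp.out, Nat.cast_sum, Finset.sum_mul]
    refine Finset.sum_congr rfl fun j hj => ?_
    congr 1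
    exact if_pos (pow_dvd_pow p (Nat.lt_succ_iff.mp (Finset.mem_range.mp hj)))
  -- Orders `p^j` with `j > k - s` are reindexed by `j = k - v`.
  · rw [← Finset.sum_range_reflect]
    refine Finset.sum_congr rfl fun v hv => ?_
    have hv := Finset.mem_range.mp hv
    have h1 : k - s + 1 + (s - 1 - v) = k - v := by omega
    rw [h1]
    have h2 : F (p ^ (k - v)) = _ := if_neg fun h => by
      have := (Nat.pow_dvd_pow_iff_le_right hp1).mp h
      omega
    rw [h2, Nat.pow_div (by omega) hp.out.pos, Nat.sub_sub_self (by omega)]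

/-- Reduction mod `p` forces `d ∣ n`; for `n = d m`, factor `a^n - 1 = (a^d - 1) S_m(a^d)` and lift
the exponent for `a^d`. -/
theorem prime_pow_dvd_pow_sub_one_iff {t d : ℕ} (hp2 : p ≠ 2) (hd0 : 0 < d)
    (hd : d = orderOf (a : ZMod p))
    (h : ∀ j ≤ k, ∀ T : ℤ, ((p ^ j : ℕ) : ℤ) ∣ (a ^ d - 1) * T ↔ ((p ^ (j - t) : ℕ) : ℤ) ∣ T)
    {j : ℕ} (hj : 1 ≤ j) (hjk : j ≤ k) (n : ℕ) :
    ((p ^ j : ℕ) : ℤ) ∣ a ^ n - 1 ↔ d * p ^ (j - t) ∣ n := by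
  have hdvd : ∀ n : ℕ, (p : ℤ) ∣ a ^ n - 1 ↔ d ∣ n := fun n => by
    rw [hd, orderOf_dvd_iff_pow_eq_one, ZMod.intCast_pow_eq_one_iff, mul_geom_sum]
  have hpj : (p : ℤ) ∣ ((p ^ j : ℕ) : ℤ) := Int.natCast_dvd_natCast.mpr (dvd_pow_self p (by omega))
  by_cases hdn : d ∣ n
  · obtain ⟨m, rfl⟩ := hdn
    rw [pow_mul, ← mul_geom_sum, h j hjk,
      prime_pow_dvd_geom_sum_iff ((hdvd d).mpr dvd_rfl) fun h => absurd h hp2]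
    exact (Nat.mul_dvd_mul_iff_left hd0).symm
  · exact iff_of_false (fun h => hdn ((hdvd n).mp (hpj.trans h)))
      fun h => hdn ((dvd_mul_right _ _).trans h)

/-- Since `a - 1` is a unit, every `b` falls in the torsion case with `s = 0`, and all `p^k` maps
have the same cycle type. -/
theorem cycleCounter_holA_of_sub_one_coprime {t d : ℕ} (hp2 : p ≠ 2) (hk : 1 ≤ k)
    (hcop : IsCoprime ((p ^ k : ℕ) : ℤ) a) (ha1 : ¬ (p : ℤ) ∣ a - 1)
    (hd : d = orderOf (a : ZMod p)) (ht1 : 1 ≤ t) (ht : t ≤ k)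
    (h : ∀ j ≤ k, ∀ T : ℤ, ((p ^ j : ℕ) : ℤ) ∣ (a ^ d - 1) * T ↔ ((p ^ (j - t) : ℕ) : ℤ) ∣ T) :
    cycleCounter (holA (p ^ k) a)
      = ((p ^ k : ℕ) : MvPolynomial ℕ+ ℚ) * cycVar 1 * cycVar d ^ ((p ^ t - 1) / d)
          * ∏ v ∈ Finset.Icc 1 (k - t), cycVar (p ^ v * d) ^ (p ^ (t - 1) * (p - 1) / d) := by
  obtain ⟨u, hu⟩ := exists_unit_eq_intCast hcop
  have hpZ : Prime (p : ℤ) := Nat.prime_iff_prime_int.mp hp.out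
  have hcop1 : IsCoprime (p : ℤ) (a - 1) := (Prime.coprime_iff_not_dvd hpZ).mpr ha1
  obtain ⟨w, hw⟩ := exists_unit_eq_intCast (m := p ^ k) (a := a - 1) (by
    rw [Nat.cast_pow]; exact hcop1.pow_left)
  have hcopp : IsCoprime (p : ℤ) a := by
    rw [Nat.cast_pow] at hcop
    exact (IsCoprime.pow_left_iff (by omega)).mp hcop
  have hdp : d ∣ p - 1 := by
    rw [hd]
    refine orderOf_dvd_of_pow_eq_one (ZMod.pow_card_sub_one_eq_one ?_)
    rw [Ne, ZMod.intCast_zmod_eq_zero_iff_dvd]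
    exact (Prime.coprime_iff_not_dvd hpZ).mp hcopp
  obtain ⟨D, hD⟩ := hdp
  have hp1 := hp.out.one_lt
  have hd0 : 0 < d := Nat.pos_of_ne_zero fun h0 => by rw [h0, zero_mul] at hD; omega
  have hCT : ∀ b : ZMod (p ^ k), cycleTypeMonomial (affinePerm u b)
      = cycVar 1 * cycVar d ^ ((p ^ t - 1) / d)
          * ∏ v ∈ Finset.Icc 1 (k - t), cycVar (p ^ v * d) ^ (p ^ (t - 1) * (p - 1) / d) := by
    intro b
    rw [cycleTypeMonomial_affinePerm_of_torsion hu (Nat.zero_le k) w.isUnit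
      (by rw [hw]; push_cast; ring) (by simp) (fun j => if j = 0 then 1 else d * p ^ (j - t))
      (fun j => if j = 0 then 1 else p ^ (min j t - 1) * D)]
    · rw [Finset.prod_range_succ', Nat.sub_zero, if_pos rfl, if_pos rfl, pow_one]
      -- Orders `p^j` with `1 ≤ j ≤ t` all give period `d`; their cycle counts sum to `D (1 + ⋯ +
      -- p^(t-1)) = (p^t - 1)/d`. Beyond `t` the period grows by a factor `p` each time.
      have hkt : k = t + (k - t) := by omega
      conv_lhs => rw [hkt]
      rw [Finset.prod_range_add, mul_comm, ← mul_assoc]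
      congr 1
      · rw [Finset.prod_congr rfl fun i hi => ?_, Finset.prod_pow_eq_pow_sum (f := fun i => p ^ i * D)]
        · congr 2
          rw [← Finset.sum_mul]
          symm
          apply Nat.div_eq_of_eq_mul_right hd0
          rw [← geom_sum_mul_of_one_le hp1.le, hD]
          ring
        · have hi := Finset.mem_range.mp hi
          simp only [Nat.succ_ne_zero, if_false]
          rw [Nat.sub_eq_zero_of_le (by omega : i + 1 ≤ t), pow_zero, mul_one,
            Nat.min_eq_left (by omega), Nat.add_sub_cancel]
      · rw [Finset.prod_Icc_eq_prod_range, Nat.add_sub_cancel]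
        refine Finset.prod_congr rfl fun i _ => ?_
        simp only [Nat.succ_ne_zero, if_false]
        rw [Nat.min_eq_right (by omega), show t + i + 1 - t = 1 + i by omega, mul_comm d, hD,
          mul_left_comm, Nat.mul_div_cancel_left _ hd0]
    · intro j hj n
      rcases Nat.eq_zero_or_pos j with rfl | hj0
      · simp
      · rw [if_neg hj0.ne', ← prime_pow_dvd_pow_sub_one_iff hp2 hd0 hd h hj0 (by omega), ← mul_geom_sum]
        rw [Nat.cast_pow]
        exact ⟨fun h => h.mul_left _, fun h => hcop1.pow_left.dvd_of_dvd_mul_left h⟩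
    · intro j _
      rcases Nat.eq_zero_or_pos j with rfl | hj0
      · simp
      · simp only [if_neg hj0.ne']
        rw [Nat.totient_prime_pow hp.out hj0, hD, pow_zero, one_mul]
        have h1 : j - 1 = (j - t) + (min j t - 1) := by omega
        rw [h1, pow_add]; ring
  rw [cycleCounter_holA_eq_sum u hu, Finset.sum_congr rfl fun b _ => hCT b, Finset.sum_const,
    Finset.card_univ, ZMod.card, nsmul_eq_mul]
  ring

end PrimePowerCycleCounters

/-! ### Powers of two: multipliers congruent to 3 mod 4, and powers of 5 -/

section TwoPower

variable {k s : ℕ} {a : ℤ}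

/-- `S_n` has the parity of `n`, and `S_{2m}(a) = (1 + a) S_m(a^2)` with `4 ∣ a^2 - 1`, so lifting
the exponent applies to the second factor. Evenness of `n` accounts for the `max 1`. -/
theorem two_pow_dvd_geom_sum_iff (h4 : 4 ∣ -a - 1)
    (h : ∀ j ≤ k, ∀ T : ℤ, ((2 ^ j : ℕ) : ℤ) ∣ (-a - 1) * T ↔ ((2 ^ (j - s) : ℕ) : ℤ) ∣ T)
    {j : ℕ} (hj : 1 ≤ j) (hjk : j ≤ k) (n : ℕ) :
    ((2 ^ j : ℕ) : ℤ) ∣ ∑ i ∈ Finset.range n, a ^ i ↔ 2 ^ max 1 (j + 1 - s) ∣ n := by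
  have hparity : ∀ n : ℕ, (2 : ℤ) ∣ (∑ i ∈ Finset.range n, a ^ i) - n := by
    intro n
    induction n with
    | zero => simp
    | succ n ih =>
      have h1 : (2 : ℤ) ∣ a ^ n - 1 := by
        have := sub_dvd_pow_sub_pow a 1 n
        rw [one_pow] at this
        exact (by omega : (2 : ℤ) ∣ a - 1).trans this
      rw [Finset.sum_range_succ, Nat.cast_succ]
      omega
  have hdouble : ∀ m : ℕ, ∑ i ∈ Finset.range (2 * m), a ^ i
      = (1 + a) * ∑ i ∈ Finset.range m, (a ^ 2) ^ i := by
    intro m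
    induction m with
    | zero => simp
    | succ m ih =>
      rw [Nat.mul_succ, Finset.sum_range_succ, Finset.sum_range_succ, ih, Finset.sum_range_succ,
        ← pow_mul]
      ring
  have h2 : (2 : ℕ) ∣ 2 ^ max 1 (j + 1 - s) := dvd_pow_self 2 (by omega)
  by_cases hn : 2 ∣ n
  · obtain ⟨m, rfl⟩ := hn
    have hsq : (4 : ℤ) ∣ a ^ 2 - 1 := by
      have : a ^ 2 - 1 = (-a - 1) * (1 - a) := by ring
      rw [this]; exact h4.mul_right _
    rw [hdouble, ← dvd_neg, ← neg_mul, show -(1 + a) = -a - 1 by ring, h j hjk]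
    have hp : Fact (Nat.Prime 2) := ⟨Nat.prime_two⟩
    rw [prime_pow_dvd_geom_sum_iff (p := 2) ((by norm_num : (2 : ℤ) ∣ 4).trans hsq) fun _ => hsq,
      show max 1 (j + 1 - s) = (j - s) + 1 by omega, pow_succ',
      Nat.mul_dvd_mul_iff_left two_pos]
  · refine iff_of_false (fun h0 => hn ?_) fun h0 => hn (h2.trans h0)
    have h3 : (2 : ℤ) ∣ ((2 ^ j : ℕ) : ℤ) := Int.natCast_dvd_natCast.mpr (dvd_pow_self 2 (by omega))
    have h4 := h3.trans h0
    have := hparity n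
    omega

/-- As `a - 1` is twice an odd number, only two cycle types occur: one for even `b` (the torsion
case) and one for odd `b`, each `2^(k-1)` times. -/
theorem cycleCounter_holA_two_pow_of_neg_unipotent (hk : 2 ≤ k) (hs : s ≤ k) (hs2 : 2 ≤ s)
    (h4 : 4 ∣ -a - 1)
    (h : ∀ j ≤ k, ∀ T : ℤ, ((2 ^ j : ℕ) : ℤ) ∣ (-a - 1) * T ↔ ((2 ^ (j - s) : ℕ) : ℤ) ∣ T) :
    cycleCounter (holA (2 ^ k) a)
      = 2 ^ (k - 1) * cycVar (2 ^ (k + 1 - s)) ^ (2 ^ (s - 1))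
        + 2 ^ (k - 1) * cycVar 1 ^ 2 * cycVar 2 ^ (2 ^ (min s (k - 1)) - 1)
          * ∏ v ∈ Finset.Icc 2 (k - min s (k - 1)),
              cycVar (2 ^ v) ^ (2 ^ (min s (k - 1) - 1)) := by
  have hp : Fact (Nat.Prime 2) := ⟨Nat.prime_two⟩
  have hodd : ∀ z : ℤ, ¬ 2 ∣ z → IsCoprime ((2 ^ k : ℕ) : ℤ) z := fun z hz => by
    rw [Nat.cast_pow]
    exact ((Prime.coprime_iff_not_dvd Int.prime_two).mpr hz).pow_left
  obtain ⟨u, hu⟩ := exists_unit_eq_intCast (hodd a (by omega))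
  obtain ⟨z, hz⟩ : (2 : ℤ) ∣ a - 1 := by omega
  obtain ⟨w, hw⟩ := exists_unit_eq_intCast (hodd z (by omega))
  have ha : (a : ZMod (2 ^ k)) - 1 = (2 ^ 1 : ℕ) * (w : ZMod (2 ^ k)) := by
    rw [hw, ← Int.cast_one, ← Int.cast_sub, hz]; push_cast; ring
  have hS0 : ∀ n : ℕ, ((2 ^ 0 : ℕ) : ℤ) ∣ ∑ i ∈ Finset.range n, a ^ i ↔ 1 ∣ n := fun n => by simp
  -- For even `b` the displacement orders `2^j` stop at `j = k - 1`, and period 2 occurs for `1 ≤ j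
  -- ≤ s`; `r` counts these `j`, also when `s = k`.
  set r := min s (k - 1) with hr
  let A : MvPolynomial ℕ+ ℚ := cycVar 1 ^ 2 * cycVar 2 ^ (2 ^ r - 1)
    * ∏ v ∈ Finset.Icc 2 (k - r), cycVar (2 ^ v) ^ (2 ^ (r - 1))
  let B : MvPolynomial ℕ+ ℚ := cycVar (2 ^ (k + 1 - s)) ^ (2 ^ (s - 1))
  let F : ℕ → MvPolynomial ℕ+ ℚ := fun q => if q ∣ 2 ^ (k - 1) then A else B
  have hF : ∀ b : ZMod (2 ^ k), cycleTypeMonomial (affinePerm u b) = F (addOrderOf b) := by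
    intro b
    by_cases hb : 2 ^ (k - 1) • b = 0
    · have hF : F (addOrderOf b) = A := if_pos (addOrderOf_dvd_iff_nsmul_eq_zero.mpr hb)
      rw [hF, cycleTypeMonomial_affinePerm_of_torsion hu (by omega) w.isUnit ha hb
        (fun j => if j = 0 then 1 else 2 ^ max 1 (j + 1 - s))
        (fun j => if j = 0 then 2 else 2 ^ (min j s - 1))]
      · rw [Finset.prod_range_succ', if_pos rfl, if_pos rfl, show k - 1 = r + (k - 1 - r) by omega,
          Finset.prod_range_add, mul_comm, ← mul_assoc]
        change _ = cycVar 1 ^ 2 * cycVar 2 ^ (2 ^ r - 1) * _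
        congr 1
        · congr 1
          rw [Finset.prod_congr rfl fun i hi => ?_, Finset.prod_pow_eq_pow_sum (f := fun i => 2 ^ i),
            Nat.geomSum_eq le_rfl, Nat.div_one]
          have hi := Finset.mem_range.mp hi
          simp only [Nat.succ_ne_zero, if_false]
          rw [show max 1 (i + 1 + 1 - s) = 1 by omega, pow_one,
            show min (i + 1) s - 1 = i by omega]
        · rw [Finset.prod_Icc_eq_prod_range, show k - r + 1 - 2 = k - 1 - r by omega]
          refine Finset.prod_congr rfl fun i hi => ?_
          have hi := Finset.mem_range.mp hi
          simp only [Nat.add_eq_zero_iff, one_ne_zero, and_false, if_false]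
          rw [show max 1 (r + i + 1 + 1 - s) = 2 + i by omega,
            show min (r + i + 1) s - 1 = r - 1 by omega]
      · intro j hj n
        rcases Nat.eq_zero_or_pos j with rfl | hj0
        · exact hS0 n
        · rw [if_neg hj0.ne', two_pow_dvd_geom_sum_iff h4 h hj0 (by omega)]
      · intro j hj
        rcases Nat.eq_zero_or_pos j with rfl | hj0
        · simp
        · simp only [if_neg hj0.ne']
          rw [Nat.totient_prime_pow Nat.prime_two hj0, ← pow_add, Nat.add_one_sub_one, mul_one,
            ← pow_add]
          congr 1; omega
    · have hF : F (addOrderOf b) = B := if_neg (mt addOrderOf_dvd_iff_nsmul_eq_zero.mp hb)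
      have hbk : addOrderOf b = 2 ^ k := by
        obtain ⟨j, hj, hbj⟩ := ZMod.exists_addOrderOf_eq_prime_pow b
        rw [← addOrderOf_dvd_iff_nsmul_eq_zero, hbj, Nat.pow_dvd_pow_iff_le_right one_lt_two] at hb
        rw [hbj, show j = k by omega]
      rw [hF, cycleTypeMonomial_affinePerm_of_not_torsion hu (by omega : 1 ≤ k) ha hb (fun n => ?_)]
      · rw [← pow_add]; congr 1; omega
      · rw [hbk, two_pow_dvd_geom_sum_iff h4 h (by omega) le_rfl,
          show max 1 (k + 1 - s) = k + 1 - s by omega]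
  rw [cycleCounter_holA_eq_sum u hu, Finset.sum_congr rfl fun b _ => hF b, ZMod.sum_addOrderOf,
    Finset.sum_range_succ, add_comm]
  congr 1
  · have hFk : F (2 ^ k) = B := if_neg fun h => by
      have := (Nat.pow_dvd_pow_iff_le_right one_lt_two).mp h
      omega
    rw [hFk, Nat.totient_prime_pow Nat.prime_two (by omega)]
    simp [B]
  · have h1 : ∀ j ∈ Finset.range k, ((2 ^ j).totient : MvPolynomial ℕ+ ℚ) * F (2 ^ j)
        = ((2 ^ j).totient : MvPolynomial ℕ+ ℚ) * A := fun j hj => by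
      have hj := Finset.mem_range.mp hj
      congr 1
      exact if_pos (pow_dvd_pow 2 (by omega))
    rw [Finset.sum_congr rfl h1, ← Finset.sum_mul, ← Nat.cast_sum,
      show k = k - 1 + 1 by omega, sum_totient_prime_pow Nat.prime_two, Nat.add_sub_cancel]
    simp only [A, Nat.cast_pow, Nat.cast_ofNat, mul_assoc]
    rw [show k - 1 + 1 = k by omega]

/-- A counting argument: modulo `2^(k+2)`, the elements `5^n - 1` are multiples of 4, of which there
are `2^k`, and `5` has order `2^k`. -/
theorem intCast_mem_powers_five_iff (hk : 2 ≤ k) :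
    (a : ZMod (2 ^ k)) ∈ Submonoid.powers (5 : ZMod (2 ^ k)) ↔ 4 ∣ a - 1 := by
  classical
  obtain ⟨k, rfl⟩ := Nat.exists_eq_add_of_le' hk
  have h4k : (4 : ℤ) ∣ ((2 ^ (k + 2) : ℕ) : ℤ) := ⟨2 ^ k, by push_cast; ring⟩
  have h5 : ∀ n : ℕ, (4 : ℤ) ∣ 5 ^ n - 1 := fun n => by
    simpa using sub_dvd_pow_sub_pow (5 : ℤ) 1 n
  have htors : ∀ c : ℤ, 4 ∣ c ↔ 2 ^ k • (c : ZMod (2 ^ (k + 2))) = 0 := fun c => by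
    rw [nsmul_eq_mul, ← Int.cast_natCast, ← Int.cast_mul, ZMod.intCast_zmod_eq_zero_iff_dvd,
      pow_add, Nat.cast_mul, mul_dvd_mul_iff_left (by positivity)]
    norm_num
  constructor
  · rintro ⟨n, hn⟩
    simp only at hn
    have h1 : (((5 : ℤ) ^ n - a : ℤ) : ZMod (2 ^ (k + 2))) = 0 := by
      push_cast; rw [hn, sub_self]
    have h2 := h4k.trans ((ZMod.intCast_zmod_eq_zero_iff_dvd _ _).mp h1)
    have := h5 n
    omega
  · intro ha
    let T := Finset.univ.filter fun z : ZMod (2 ^ (k + 2)) => 2 ^ k • z = 0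
    have hT : T.card = 2 ^ k := ZMod.card_nsmul_eq_zero (pow_dvd_pow 2 (by omega))
    have himg : (Finset.range (2 ^ k)).image (fun n => (5 : ZMod (2 ^ (k + 2))) ^ n - 1) = T := by
      refine Finset.eq_of_subset_of_card_le (fun z hz => ?_) ?_
      · obtain ⟨n, -, rfl⟩ := Finset.mem_image.mp hz
        refine Finset.mem_filter.mpr ⟨Finset.mem_univ _, ?_⟩
        have := (htors _).mp (h5 n)
        push_cast at this
        exact this
      · rw [hT, Finset.card_image_of_injOn, Finset.card_range]
        intro n hn n' hn' hnn
        rw [← ZMod.orderOf_five k, Finset.coe_range] at hn hn'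
        exact pow_injOn_Iio_orderOf hn hn' (sub_left_injective hnn)
    have haT : (a : ZMod (2 ^ (k + 2))) - 1 ∈ T := by
      refine Finset.mem_filter.mpr ⟨Finset.mem_univ _, ?_⟩
      have := (htors _).mp ha
      push_cast at this
      exact this
    rw [← himg] at haT
    obtain ⟨n, -, hn⟩ := Finset.mem_image.mp haT
    exact ⟨n, sub_left_injective hn⟩

end TwoPower

/-! ### Matching the polynomials Γ with the order data -/

section PrimePowers

theorem cycleCounter_holA_of_eq_one {m : ℕ} [NeZero m] (hm : m = 1) (a : ℤ) :
    cycleCounter (holA m a) = cycVar 1 := by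
  subst hm
  exact cycleCounter_holA_one a

/-- With the integer `1` as multiplier `S_n = n` outright. This serves the modulus 2, where a
general odd `a` need not be 1 mod 4. -/
theorem cycleCounter_holA_prime_pow_one {p k : ℕ} [hp : Fact p.Prime] (hk : 1 ≤ k) :
    cycleCounter (holA (p ^ k) 1)
      = cycVar 1 ^ (p ^ k) + ∑ v ∈ Finset.range k,
          ((p ^ (k - v)).totient : MvPolynomial ℕ+ ℚ) * cycVar (p ^ (k - v)) ^ (p ^ v) := by
  rw [cycleCounter_holA_of_unipotent (a := 1) (le_refl k) hk isCoprime_one_right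
    ⟨1, isUnit_one, by simp⟩ fun j n => ?_]
  · simp
  · simp only [one_pow, Finset.sum_const, Finset.card_range, nsmul_eq_mul, mul_one]
    exact Int.natCast_dvd_natCast

theorem cycleCounter_holA_two_pow (k : ℕ) {a : ℤ} (hcop : IsCoprime ((2 ^ k : ℕ) : ℤ) a) :
    cycleCounter (holA (2 ^ k) a) = gammaPoly 2 k (orderDatum 2 k a) := by
  have hp : Fact (Nat.Prime 2) := ⟨Nat.prime_two⟩
  have hodd : 1 ≤ k → ¬ 2 ∣ a := fun hk => by
    rw [Nat.cast_pow] at hcop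
    exact (Prime.coprime_iff_not_dvd Int.prime_two).mp ((IsCoprime.pow_left_iff hk).mp hcop)
  rw [orderDatum, if_pos rfl]
  obtain rfl | rfl | hk : k = 0 ∨ k = 1 ∨ 2 ≤ k := by omega
  · exact cycleCounter_holA_of_eq_one (pow_zero 2) a
  · have ha : (a : ZMod (2 ^ 1)) = (1 : ℤ) := by
      rw [ZMod.intCast_eq_intCast_iff_dvd_sub]
      have := hodd le_rfl
      norm_num
      omega
    rw [holA_congr ha, cycleCounter_holA_prime_pow_one le_rfl]
    simp [gammaPoly]
  have h2a := hodd (by omega)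
  rw [if_neg (by omega)]
  have hpow := intCast_mem_powers_five_iff (a := a) hk
  split_ifs with h5
  · have h4 := hpow.mp h5
    obtain ⟨s, hs, hw, h⟩ := exists_capped_valuation (p := 2) (a - 1) k
    have hs2 : 2 ≤ s := le_of_forall_prime_pow_dvd_mul_iff hk h (by simpa using h4)
    have hS := prime_pow_dvd_geom_sum_iff (p := 2) (a := a) (by norm_num; omega) fun _ => h4
    rw [cycleCounter_holA_of_unipotent hs (by omega) hcop hw hS,
      orderOf_eq_of_geom_sum_dvd_iff h hS]
    simp only [gammaPoly, if_neg (show k ≠ 0 by omega), if_neg (show k ≠ 1 by omega)]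
    split_ifs with hk2
    · obtain rfl : s = 2 := by omega
      subst hk2
      have h4t : Nat.totient 4 = 2 := by decide
      simp [gammaFour, Finset.sum_range_succ, h4t]
      ring
    · rw [padicValNat.prime_pow, gammaTwoPow, if_neg (by decide)]
      -- The order is `2^(k-s)`, so `ν = s - 2`.
      rw [show k - 2 - (k - 2 - (k - s)) = k - s by omega,
        show 2 + (k - 2 - (k - s)) = s by omega, show 1 + (k - 2 - (k - s)) = s - 1 by omega,
        show k - 2 - (k - s) + 2 = s by omega]
      simp
  · have h4 := mt hpow.mpr h5
    have h4' : 4 ∣ -a - 1 := by omega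
    obtain ⟨s, hs, -, h⟩ := exists_capped_valuation (p := 2) (-a - 1) k
    have hs2 : 2 ≤ s := le_of_forall_prime_pow_dvd_mul_iff hk h (by simpa using h4')
    have hS := prime_pow_dvd_geom_sum_iff (p := 2) (a := -a) (by norm_num; omega) fun _ => h4'
    rw [cycleCounter_holA_two_pow_of_neg_unipotent hk hs hs2 h4' h, ← Int.cast_neg,
      orderOf_eq_of_geom_sum_dvd_iff h hS]
    simp only [gammaPoly, if_neg (show k ≠ 0 by omega), if_neg (show k ≠ 1 by omega)]
    split_ifs with hk2
    · obtain rfl : s = 2 := by omega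
      subst hk2
      simp [gammaFour]
      ring
    · rw [padicValNat.prime_pow, gammaTwoPow, if_pos rfl]
      -- Again `ν = s - 2`, now for `-a`, and `ν' = min(s, k - 1) - 2`.
      rw [show min (k - 3) (k - 2 - (k - s)) = min s (k - 1) - 2 by omega,
        show k - 1 - (k - 2 - (k - s)) = k + 1 - s by omega,
        show 1 + (k - 2 - (k - s)) = s - 1 by omega,
        show 2 + (min s (k - 1) - 2) = min s (k - 1) by omega,
        show k - 2 - (min s (k - 1) - 2) = k - min s (k - 1) by omega,
        show 1 + (min s (k - 1) - 2) = min s (k - 1) - 1 by omega]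

/-- For `k ≥ 1`, the order of `a` is `d` times a power of `p`, with `d ∣ p - 1` the order mod `p`.
The two cases of Γ are thus `d = 1` and `d ≠ 1`, that is, `p ∣ a - 1` or not. -/
theorem cycleCounter_holA_odd_prime_pow {p : ℕ} [hp : Fact p.Prime] (hp2 : p ≠ 2) (k : ℕ) {a : ℤ}
    (hcop : IsCoprime ((p ^ k : ℕ) : ℤ) a) :
    cycleCounter (holA (p ^ k) a) = gammaPoly p k (orderDatum p k a) := by
  rw [orderDatum, if_neg hp2]
  change _ = gammaOdd p k _
  rcases Nat.eq_zero_or_pos k with rfl | hk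
  · have h1 : orderOf (a : ZMod (p ^ 0)) = 1 := by
      have : Subsingleton (ZMod (p ^ 0)) := by rw [pow_zero]; exact ZMod.subsingleton_iff.mpr rfl
      rw [orderOf_eq_one_iff]; exact Subsingleton.elim _ _
    rw [cycleCounter_holA_of_eq_one (pow_zero p), h1]
    simp [gammaOdd]
  have hp1 := hp.out.one_lt
  have hpart : primePart p (p ^ k).totient = p ^ (k - 1) := by
    have hpp : ¬ p ∣ p - 1 := fun h => absurd (Nat.le_of_dvd (by omega) h) (by omega)
    rw [primePart, Nat.totient_prime_pow hp.out hk, padicValNat.mul (pow_ne_zero _ (by omega))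
      (by omega), padicValNat.prime_pow, padicValNat.eq_zero_of_not_dvd hpp, add_zero]
  rw [gammaOdd, hpart]
  by_cases ha1 : (p : ℤ) ∣ a - 1
  · obtain ⟨s, hs, hw, h⟩ := exists_capped_valuation (p := p) (a - 1) k
    have hs1 : 1 ≤ s := le_of_forall_prime_pow_dvd_mul_iff hk h (by simpa using ha1)
    have hS := prime_pow_dvd_geom_sum_iff ha1 fun h => absurd h hp2
    rw [cycleCounter_holA_of_unipotent hs hs1 hcop hw hS, orderOf_eq_of_geom_sum_dvd_iff h hS,
      if_pos (pow_dvd_pow p (by omega)), padicValNat.prime_pow, Nat.pow_div (by omega) hp.out.pos,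
      Nat.pow_div (by omega) hp.out.pos, show k - (k - s) = s by omega,
      show k - 1 - (k - s) = s - 1 by omega]
  · set d := orderOf (a : ZMod p) with hd
    have hpZ : Prime (p : ℤ) := Nat.prime_iff_prime_int.mp hp.out
    have hdvd : (p : ℤ) ∣ a ^ d - 1 := by
      rw [← mul_geom_sum, ← ZMod.intCast_pow_eq_one_iff]
      exact pow_orderOf_eq_one _
    obtain ⟨t, ht, -, h⟩ := exists_capped_valuation (p := p) (a ^ d - 1) k
    have ht1 : 1 ≤ t := le_of_forall_prime_pow_dvd_mul_iff hk h (by simpa using hdvd)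
    have hcopp : IsCoprime (p : ℤ) a := by
      rw [Nat.cast_pow] at hcop
      exact (IsCoprime.pow_left_iff hk).mp hcop
    have hdp : d ∣ p - 1 := by
      refine orderOf_dvd_of_pow_eq_one (ZMod.pow_card_sub_one_eq_one ?_)
      rw [Ne, ZMod.intCast_zmod_eq_zero_iff_dvd]
      exact (Prime.coprime_iff_not_dvd hpZ).mp hcopp
    have hd0 : 0 < d := Nat.pos_of_dvd_of_pos hdp (by omega)
    have hpd : ¬ p ∣ d := fun h' => absurd (Nat.le_of_dvd (by omega) (h'.trans hdp)) (by omega)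
    have hd1 : d ≠ 1 := fun h1 => ha1 (by simpa [h1] using hdvd)
    have hord : orderOf (a : ZMod (p ^ k)) = d * p ^ (k - t) := by
      refine Nat.dvd_right_iff_eq.mp fun n => ?_
      rw [orderOf_dvd_iff_pow_eq_one, ZMod.intCast_pow_eq_one_iff, mul_geom_sum,
        prime_pow_dvd_pow_sub_one_iff hp2 hd0 hd h hk le_rfl]
    have hval : padicValNat p (d * p ^ (k - t)) = k - t := by
      rw [padicValNat.mul hd0.ne' (pow_ne_zero _ (by omega)), padicValNat.eq_zero_of_not_dvd hpd,
        padicValNat.prime_pow, zero_add]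
    have hcp : coprimePart p (d * p ^ (k - t)) = d := by
      rw [coprimePart, primePart, hval, Nat.mul_div_cancel _ (pow_pos hp.out.pos _)]
    have hnd : ¬ d * p ^ (k - t) ∣ p ^ (k - 1) := fun h' => hd1 (Nat.Coprime.eq_one_of_dvd
      (((Nat.Prime.coprime_iff_not_dvd hp.out).mpr hpd).symm.pow_right (k - 1))
      ((dvd_mul_right _ _).trans h'))
    rw [hord, if_neg hnd, hval, hcp,
      cycleCounter_holA_of_sub_one_coprime hp2 hk hcop ha1 hd ht1 ht h,
      show k - (k - t) = t by omega, show k - 1 - (k - t) = t - 1 by omega]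

theorem cycleCounter_holA_prime_pow {p : ℕ} [hp : Fact p.Prime] (k : ℕ) {a : ℤ}
    (hcop : IsCoprime ((p ^ k : ℕ) : ℤ) a) :
    cycleCounter (holA (p ^ k) a) = gammaPoly p k (orderDatum p k a) := by
  by_cases hp2 : p = 2
  · subst hp2
    exact cycleCounter_holA_two_pow k hcop
  · exact cycleCounter_holA_odd_prime_pow hp2 k hcop

theorem cycleCounter_holA_eq_starFinprod_gammaPoly {m : ℕ} [NeZero m] {a : ℤ}
    (ha : IsCoprime (m : ℤ) a) :
    cycleCounter (holA m a)
      = starFinprod fun p : Nat.Primes => gammaPoly p (padicValNat p m) (orderVector m a p) := by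
  refine cycleCounter_holA_eq_starFinprod ha _ fun p _ => ?_
  have hp : Fact (p : ℕ).Prime := ⟨p.2⟩
  refine cycleCounter_holA_prime_pow _ ?_
  exact ha.of_isCoprime_of_dvd_left (Int.natCast_dvd_natCast.mpr pow_padicValNat_dvd)

/-- Read off from the case `k = 0` of the prime power formula; it makes primes not dividing `m`
contribute the neutral element. -/
theorem gammaPoly_zero_orderDatum {p : ℕ} [hp : Fact p.Prime] (a : ℤ) :
    gammaPoly p 0 (orderDatum p 0 a) = X 1 := by
  rw [← cycleCounter_holA_prime_pow 0 (by simpa using isCoprime_one_left),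
    cycleCounter_holA_of_eq_one (pow_zero p)]
  rfl

theorem finite_gammaPoly_ne_X_one {m : ℕ} [NeZero m] (a : ℤ) :
    {p : Nat.Primes | gammaPoly p (padicValNat p m) (orderVector m a p) ≠ X 1}.Finite := by
  refine Set.Finite.subset (Set.Finite.preimage (f := fun p : Nat.Primes => (p : ℕ))
    (fun p _ q _ h => Subtype.ext h) (Finset.finite_toSet m.primeFactors)) fun p hp => ?_
  have hp' : Fact (p : ℕ).Prime := ⟨p.2⟩
  by_contra hpm
  refine hp ?_
  have h0 : padicValNat p m = 0 := padicValNat.eq_zero_of_not_dvd fun h =>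
    hpm (Nat.mem_primeFactors.mpr ⟨p.2, h, NeZero.ne m⟩)
  rw [orderVector, h0]
  exact gammaPoly_zero_orderDatum a

end PrimePowers

theorem mainTheorem12 :
    -- prime powers: `Γ_{p^k}(o)` is the cycle counter of `Hol_a(ℤ/p^kℤ)` if `o_{p^k}(a) = o`
    (∀ (p k : ℕ) [Fact p.Prime], ∀ o ∈ orderData p k, ∀ a : ℤ,
      IsCoprime ((p ^ k : ℕ) : ℤ) a → orderDatum p k a = o →
        cycleCounter (holA (p ^ k) a) = gammaPoly p k o) ∧
    -- general `m`: the cycle counter is the `⊛`-product of the `Γ_{p^{ν_p(m)}}(o_p)`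
    (∀ (m : ℕ) [NeZero m], ∀ o : Nat.Primes → OrderDatum,
      (∀ p : Nat.Primes, o p ∈ orderData p (padicValNat p m)) →
        ∀ a : ℤ, IsCoprime (m : ℤ) a → orderVector m a = o →
          {p : Nat.Primes | gammaPoly p (padicValNat p m) (o p) ≠ MvPolynomial.X 1}.Finite ∧
          cycleCounter (holA m a) =
            starFinprod fun p : Nat.Primes => gammaPoly p (padicValNat p m) (o p)) ∧
    -- the cycle counter depends only on the order data
    (∀ (m : ℕ) [NeZero m], ∀ a a' : ℤ, IsCoprime (m : ℤ) a → IsCoprime (m : ℤ) a' →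
      orderVector m a = orderVector m a' →
        cycleCounter (holA m a) = cycleCounter (holA m a')) := by
  refine ⟨?_, ?_, ?_⟩
  · rintro p k _ o - a hcop rfl
    exact cycleCounter_holA_prime_pow k hcop
  · rintro m _ o - a ha rfl
    exact ⟨finite_gammaPoly_ne_X_one a, cycleCounter_holA_eq_starFinprod_gammaPoly ha⟩
  · intro m _ a a' ha ha' h
    rw [cycleCounter_holA_eq_starFinprod_gammaPoly ha,
      cycleCounter_holA_eq_starFinprod_gammaPoly ha', h]
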